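/- Let $X\subset\mathbb R^d$ be compact, $\mu$ a non-atomic probability measure on $X$ ($\mu(\{x\})=0$ for all $x$), $\mathcal B$ the $\sigma$-algebra of $\mu$-measurable subsets of $X$ (the completion of the Borel $\sigma$-algebra), and $Z_1,\dots,Z_N\subset X$ closed sets with $\mu(Z_j)>0$, $\mu(Z_i\cap Z_j)=0$ for $i\ne j$ and $\mu(\bigcup_j Z_j)=1$. Let $T:X\to X$ satisfy (interiors and boundaries are taken in $\mathbb R^d$): (c1) for each $j$, $T|_{\mathrm{int}\,Z_j}$ extends uniquely to a continuous injective map $Z_j\to\overline{T(\mathrm{int}\,Z_j)}$; (c2) $TA,\,T^{-1}A\in\mathcal B$ for $A\in\mathcal B$, and $\mu(A)=0$ implies $\mu(T^{-1}A)=0$; (c3) the cylinder sets $Z_{j_0\cdots j_n}=\bigcap_{k=0}^n T^{-k}Z_{j_k}$ of positive measure generate $\mathcal B$ modulo $\mu$-null sets; (c4) for each $j$ there is a constant $s_j\ge 1$ with $\mu(TA)=s_j\,\mu(A)$ for all measurable $A\subseteq Z_j$; (c5) $\mu$ is ergodic: if $A\in\mathcal B$ and $T^{-1}A=A$, then $\mu(A)\in\{0,1\}$;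 (c6) $\mu\big(\bigcup_{n\ge0}T^n(\bigcup_j\partial Z_j)\big)=0$. Let $\{D_u:u\in\alpha\}$, $\alpha\subseteq\mathbb N$, enumerate without repetition the sets $T^nZ_{j_0\cdots j_n}$ ($n\ge 0$, $\mu(Z_{j_0\cdots j_n})>0$), where sets that differ by a $\mu$-null set are identified and each $D_u$ is a representative contained in a partition element $Z_{k(u)}$. Write $D_u\to D_v$ if for some $j$ one has $\mu(Z_j\cap TD_u)>0$ and $D_v=Z_j\cap TD_u$ modulo $\mu$. The Hofbauer tower is $\hat X=\bigsqcup_{u\in\alpha}D_u$, with the almost everywhere defined map $\hat T(x,u)=(Tx,v)$, where $D_v=Z_j\cap TD_u$ modulo $\mu$ if $Tx\in Z_j$. Let $\bar\mu$ be the measure on $\hat X$ that equals $\mu$ on each level $D_u$, and let $\hat X_0$ be the union of those levels that equal some $Z_j$ modulo $\mu$. Assume that $\mu$ is liftable: the measures $\hat\mu_n(A)=\frac1n\sum_{k=0}^{n-1}\bar\mu(\hat T^{-k}A\cap\hat X_0)$ converge vaguely (tested on compactly supported continuous functions on the disjoint union of copies of $X$ indexed by $\mathbb N$, where $\hat X$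 is viewed as a subset) to a non-zero Radon measure $\hat\mu$ on $\hat X$. Put $\rho(D_u)=\hat\mu(D_u)/\bar\mu(D_u)$. Let $R_u=D_u\times[0,\rho(D_u)]$ be the rug of $D_u$, let $Y=\bigsqcup_{u\in\alpha}R_u$ carry the measure $\nu=\bar\mu\times(\text{Lebesgue measure})$, and define, for almost every $(x,u,y)\in Y$, $$F(x,u,y)=\Big(Tx,\ v,\ \frac{y}{s_{k(u)}}+\sum_{t\in\alpha,\ t<u,\ D_t\to D_v}\frac{\rho(D_t)}{s_{k(t)}}\Big),\qquad \hat T(x,u)=(Tx,v).$$ Then for every $u\in\alpha$ with $\hat\mu(D_u)>0$, $\nu$-almost every point of $R_u$ returns to $R_u$ under $F$, and the first return map $F_u:R_u\to R_u$, $F_uz=F^{\tau_u(z)}z$ with $\tau_u(z)=\inf\{n\ge1:F^nz\in R_u\}$, is Bernoulli with respect to the normalised restriction of $\nu$ to $R_u$: it is isomorphic modulo null sets to the two-sided shift on $\mathcal A^{\mathbb Z}$ with a product measure $p^{\mathbb Z}$, for a finite or countable alphabet $\mathcal A$ and a probability vector $p$ on $\mathcal A$. -/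

import Mathlib

open MeasureTheory Filter Topology Set
open scoped NNReal ENNReal

noncomputable section

namespace RugTower

/-! ### Isomorphism of measure preserving systems and Bernoulli systems -/

/-- `(Y, m, F)` and `(W, m', G)` are isomorphic (modulo null sets): there are forward invariant sets
`Y'`, `W'` of full measure and a bijection from `Y'` onto `W'` which is measurable in both
directions, preserves the measure in both directions and intertwines the dynamics. The σ-algebras
are the completed ones, that is, "measurable" means `NullMeasurableSet`. -/
def IsIsomorphic {Y W : Type*} [MeasurableSpace Y] [MeasurableSpace W]
    (m : Measure Y) (F : Y → Y) (m' : Measure W) (G : W → W) : Prop :=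
  ∃ (Y' : Set Y) (W' : Set W) (φ : Y → W),
    m Y'ᶜ = 0 ∧ m' W'ᶜ = 0 ∧
    MapsTo F Y' Y' ∧ MapsTo G W' W' ∧
    BijOn φ Y' W' ∧
    (∀ z ∈ Y', φ (F z) = G (φ z)) ∧
    (∀ B ⊆ W', NullMeasurableSet B m' →
      NullMeasurableSet (Y' ∩ φ ⁻¹' B) m ∧ m (Y' ∩ φ ⁻¹' B) = m' B) ∧
    (∀ A ⊆ Y', NullMeasurableSet A m →
      NullMeasurableSet (φ '' A) m' ∧ m' (φ '' A) = m A)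

/-- The left shift on two-sided sequences. -/
def shift {A : Type*} (ω : ℤ → A) : ℤ → A := fun i => ω (i + 1)

/-- A system is Bernoulli if it is isomorphic to a two-sided Bernoulli shift: the left shift on
`ℤ → A` for a finite or countable alphabet `A`, with the product measure of a probability vector. -/
def IsBernoulli {Y : Type*} [MeasurableSpace Y] (m : Measure Y) (F : Y → Y) : Prop :=
  ∃ (A : Type) (_ : Countable A) (_ : MeasurableSpace A) (_ : DiscreteMeasurableSpace A)
    (p : Measure A) (_ : IsProbabilityMeasure p),
    IsIsomorphic m F (Measure.infinitePi (fun _ : ℤ => p)) shift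

/-! ### The class of transformations -/

/-- The points of `A ⊆ X` that are interior to `A` in `ℝᵈ`. -/
def inner {d : ℕ} {X : Set (EuclideanSpace ℝ (Fin d))} (A : Set X) : Set X :=
  {x | (x : EuclideanSpace ℝ (Fin d)) ∈ interior ((fun a : X => (a : EuclideanSpace ℝ (Fin d))) '' A)}

/-- The points of `X` that belong to the boundary of `A ⊆ X` in `ℝᵈ`. -/
def bdry {d : ℕ} {X : Set (EuclideanSpace ℝ (Fin d))} (A : Set X) : Set X :=
  {x | (x : EuclideanSpace ℝ (Fin d)) ∈ frontier ((fun a : X => (a : EuclideanSpace ℝ (Fin d))) '' A)}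

/-- The cylinder set `Z_{w₀} ∩ T⁻¹ Z_{w₁} ∩ ⋯ ∩ T⁻ⁿ Z_{wₙ}`. -/
def cylinder {X : Type*} {N : ℕ} (Z : Fin N → Set X) (T : X → X) {n : ℕ}
    (w : Fin (n + 1) → Fin N) : Set X :=
  {x | ∀ k : Fin (n + 1), T^[(k : ℕ)] x ∈ Z (w k)}

/-- A system `(X, μ, T)` on a compact `X ⊆ ℝᵈ` with a finite partition `Z` (modulo `μ`-null sets)
into closed sets, subject to the conditions below. The σ-algebra of the system is the completion
of the Borel σ-algebra with respect to `μ`, so its members are the `NullMeasurableSet`s. -/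
structure PiecewiseSystem (d : ℕ) where
  X : Set (EuclideanSpace ℝ (Fin d))
  isCompact : IsCompact X
  μ : Measure X
  isProb : IsProbabilityMeasure μ
  N : ℕ
  Z : Fin N → Set X
  T : X → X
  /-- the constant Jacobian of `T` on each partition element -/
  s : Fin N → ℝ≥0
  isClosed : ∀ j, IsClosed (Z j)
  pos : ∀ j, 0 < μ (Z j)
  overlap : ∀ i j, i ≠ j → μ (Z i ∩ Z j) = 0
  cover : μ (⋃ j, Z j) = 1
  /-- `T` on the interior of `Z j` extends uniquely to a continuous injective map
  from `Z j` to the closure of `T (int (Z j))` -/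
  extension : ∀ j, ∃! g : Z j → X, Continuous g ∧ Function.Injective g ∧
    (∀ z, g z ∈ closure (T '' inner (Z j))) ∧ ∀ z : Z j, (z : X) ∈ inner (Z j) → g z = T z
  /-- images and preimages of measurable sets are measurable, and `T` is non-singular -/
  image_meas : ∀ A, NullMeasurableSet A μ → NullMeasurableSet (T '' A) μ
  preimage_meas : ∀ A, NullMeasurableSet A μ → NullMeasurableSet (T ⁻¹' A) μ
  nonsingular : ∀ A, μ A = 0 → μ (T ⁻¹' A) = 0
  /-- the cylinder sets generate the σ-algebra modulo null sets -/
  generating : ∀ A, NullMeasurableSet A μ → ∃ A' : Set X,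
    MeasurableSet[MeasurableSpace.generateFrom
      {C : Set X | ∃ (n : ℕ) (w : Fin (n + 1) → Fin N),
        0 < μ (cylinder Z T w) ∧ C = cylinder Z T w}] A' ∧ A =ᵐ[μ] A'
  /-- locally constant Jacobian -/
  one_le_s : ∀ j, 1 ≤ s j
  jacobian : ∀ j, ∀ A ⊆ Z j, NullMeasurableSet A μ → μ (T '' A) = s j * μ A
  /-- ergodicity (invariance of `μ` is not assumed) -/
  ergodic : ∀ A, NullMeasurableSet A μ → T ⁻¹' A = A → μ A = 0 ∨ μ A = 1
  /-- the forward orbits of the boundaries of the partition elements are null -/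
  boundary_null : μ (⋃ n : ℕ, T^[n] '' ⋃ j, bdry (Z j)) = 0

/-! ### The Hofbauer tower -/

/-- The levels of the Hofbauer tower of `S`: an enumeration `(D u)`, `u ∈ α ⊆ ℕ`, of the classes
modulo `μ`-null sets of the images `Tⁿ Z_w` of the `(n+1)`-cylinders `Z_w` of positive measure,
each class being represented by a subset of the partition element that contains it. -/
structure Tower {d : ℕ} (S : PiecewiseSystem d) where
  α : Set ℕ
  D : ℕ → Set S.X
  /-- the index of the partition element that contains the level -/
  branch : ℕ → Fin S.N
  subset : ∀ u ∈ α, D u ⊆ S.Z (branch u)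
  is_image : ∀ u ∈ α, ∃ (n : ℕ) (w : Fin (n + 1) → Fin S.N),
    0 < S.μ (cylinder S.Z S.T w) ∧ D u =ᵐ[S.μ] (S.T^[n] '' cylinder S.Z S.T w : Set S.X)
  exhaust : ∀ (n : ℕ) (w : Fin (n + 1) → Fin S.N), 0 < S.μ (cylinder S.Z S.T w) →
    ∃ u ∈ α, D u =ᵐ[S.μ] (S.T^[n] '' cylinder S.Z S.T w : Set S.X)
  distinct : ∀ u ∈ α, ∀ v ∈ α, D u =ᵐ[S.μ] D v → u = v

namespace Tower

variable {d : ℕ} {S : PiecewiseSystem d} (H : Tower S)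

/-- `D u` is carried to `D v` through `Z j`: `D v = Z j ∩ T (D u)` and this set is not null. -/
def ArrowVia (u : ℕ) (j : Fin S.N) (v : ℕ) : Prop :=
  0 < S.μ (S.Z j ∩ S.T '' H.D u) ∧ H.D v =ᵐ[S.μ] (S.Z j ∩ S.T '' H.D u : Set S.X)

/-- The arrow relation `D u → D v` of the canonical Markov graph. -/
def Arrow (u v : ℕ) : Prop := ∃ j, H.ArrowVia u j v

/-- The `u`-th level as a subset of the disjoint union of the levels; a point `(x, u)` is the
point `x` of the level `D u`. -/
def level (u : ℕ) : Set (S.X × ℕ) := {p | p.2 = u ∧ p.1 ∈ H.D u}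

/-- The tower, that is the disjoint union of its levels. -/
def carrier : Set (S.X × ℕ) := ⋃ u ∈ H.α, H.level u

/-- The base of the tower: the levels which are partition elements. -/
def base : Set (S.X × ℕ) :=
  ⋃ u ∈ {u | u ∈ H.α ∧ ∃ j, H.D u =ᵐ[S.μ] S.Z j}, H.level u

open Classical in
/-- The level that contains the image of `(x, u)`: the one representing `Z j ∩ T (D u)` if
`T x ∈ Z j`. For `x` outside a null set of `D u` it exists and is unique. -/
def nextLevel (x : S.X) (u : ℕ) : ℕ :=
  if h : ∃ v ∈ H.α, ∃ j, S.T x ∈ S.Z j ∧ H.ArrowVia u j v then h.choose else u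

/-- The tower map `(x, D) ↦ (T x, Z j ∩ T D)` if `T x ∈ Z j`. -/
def towerMap (p : S.X × ℕ) : S.X × ℕ := (S.T p.1, H.nextLevel p.1 p.2)

/-- The measure on the tower that is `μ` on each level. -/
def muBar : Measure (S.X × ℕ) :=
  Measure.sum fun u : H.α => (S.μ.restrict (H.D u)).map fun x => (x, (u : ℕ))

/-- The Cesàro means `A ↦ (1/n) ∑_{k<n} muBar (towerMap⁻ᵏ A ∩ base)`. -/
def cesaro (n : ℕ) : Measure (S.X × ℕ) :=
  (n : ℝ≥0∞)⁻¹ • ∑ k ∈ Finset.range n, (H.muBar.restrict H.base).map (H.towerMap^[k])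

/-- `μ` is liftable with lift `μhat`: the Cesàro means converge to the non-zero measure `μhat`
on the tower in the vague topology (tested on compactly supported continuous functions). -/
structure IsLift (μhat : Measure (S.X × ℕ)) : Prop where
  finite_on_compacts : IsFiniteMeasureOnCompacts μhat
  on_tower : μhat H.carrierᶜ = 0
  ne_zero : μhat ≠ 0
  tendsto : ∀ f : S.X × ℕ → ℝ, Continuous f → HasCompactSupport f →
    Tendsto (fun n : ℕ => ∫ p, f p ∂(H.cesaro n)) atTop (𝓝 (∫ p, f p ∂μhat))

/-! ### The rugs, the natural extension map, and its first return maps -/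

variable (μhat : Measure (S.X × ℕ))

/-- The density `ρ(D u) = μhat (D u) / muBar (D u)`, where `muBar (D u) = μ (D u)`. -/
def rho (u : ℕ) : ℝ := (μhat (H.level u)).toReal / (S.μ (H.D u)).toReal

/-- The rug `D u × [0, ρ(D u)]`. -/
def rug (u : ℕ) : Set ((S.X × ℕ) × ℝ) := H.level u ×ˢ Icc 0 (H.rho μhat u)

/-- The domain of the natural extension: the disjoint union of the rugs. -/
def rugs : Set ((S.X × ℕ) × ℝ) := ⋃ u ∈ H.α, H.rug μhat u

/-- The measure on the rugs: the product of `muBar` and the Lebesgue measure. -/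
def nu : Measure ((S.X × ℕ) × ℝ) := (H.muBar.prod volume).restrict (H.rugs μhat)

open Classical in
/-- The height in the rug of `D v` at which the image strip of the rug of `D u` starts. -/
def offset (u v : ℕ) : ℝ :=
  ∑ t ∈ (Finset.range u).filter (fun t => t ∈ H.α ∧ H.Arrow t v),
    H.rho μhat t / (S.s (H.branch t) : ℝ)

/-- The natural extension map
`F (x, u, y) = (T x, v, y / s_j + ∑_{t < u, D t → D v} ρ(D t) / s_{k(t)})`
for `D u ⊆ Z_j`, `D t ⊆ Z_{k(t)}` and `(T x, v)` the image of `(x, u)` under the tower map. -/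
def natExt (z : (S.X × ℕ) × ℝ) : (S.X × ℕ) × ℝ :=
  (H.towerMap z.1,
    z.2 / (S.s (H.branch z.1.2) : ℝ) + H.offset μhat z.1.2 (H.towerMap z.1).2)

/-- The first return time to the rug of `D u`. -/
def returnTime (u : ℕ) (z : (S.X × ℕ) × ℝ) : ℕ :=
  sInf {n : ℕ | 1 ≤ n ∧ (H.natExt μhat)^[n] z ∈ H.rug μhat u}

/-- The first return map to the rug of `D u`. -/
def returnMap (u : ℕ) (z : (S.X × ℕ) × ℝ) : (S.X × ℕ) × ℝ :=
  (H.natExt μhat)^[H.returnTime μhat u z] z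

/-- The normalised restriction of the measure to the rug of `D u`. -/
def nuRug (u : ℕ) : Measure ((S.X × ℕ) × ℝ) :=
  (H.nu μhat (H.rug μhat u))⁻¹ • (H.nu μhat).restrict (H.rug μhat u)

end Tower

end RugTower

end

noncomputable section

namespace RugTower

/-! ### A criterion for isomorphism -/

/-! Almost every point of `D u` follows a first return path (a loop) from `u` to `u` in the Markov
graph. The points following a given loop `l` are mapped by the corresponding power of `T` onto `D
u`, modulo null sets, with constant Jacobian `jac l`. Hence the return map of the level has full
branches: the loop `l` has probability `1 / jac l`, and given the loop the image is again
distributed like normalised `μ` on `D u`.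

Along `l` the heights undergo an affine contraction of ratio `1 / jac l`, depending on `x` only
through `l`. Since `F` stacks the images of the rugs above one another, different loops yield
disjoint strips in `[0, ρ]`. Their relative lengths `1 / jac l` sum to one, so they fill the
interval up to a null set. The backward motion of the heights is therefore a full branch map with
the same symbols and the same law. Reading the loops of `x` as the future and those of `y` as the
past intertwines the return map with the shift (`shift_code`) and turns the product measure on the
rug into a product measure on sequences (`map_code`).

Two further facts are needed. Recurrence: the Cesàro means have constant densities on the levels,
and in the limit the transfer operator does not increase `ρ` (`transfer_density_le`). As total mass
is finite and preserved, the measure with density `ρ` is invariant and Poincaré recurrence applies.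
The same inequality keeps the strips inside the rugs. Injectivity of the coding: the future loops
fix the itinerary in the partition, hence `x`, because cylinders generate; the past loops fix `y`,
because the height maps contract uniformly. The uniform rate comes from non-atomicity, which
prevents a single loop from having probability one. -/

/-- Off a measurable null set `Q` the map agrees with a measurable injective one, so by
Lusin–Souslin the image of `Qᶜ` is measurable, and it has full measure. By injectivity the image of
`N` misses it. -/
theorem measure_image_null {Y W : Type*} [MeasurableSpace Y] [StandardBorelSpace Y]
    [MeasurableSpace W] [MeasurableSpace.CountablySeparated W] {m : Measure Y} {φ : Y → W}
    (hφ : AEMeasurable φ m) {Y' N : Set Y} (hY' : m Y'ᶜ = 0) (hinj : InjOn φ Y')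
    (hN : N ⊆ Y') (hN0 : m N = 0) : m.map φ (φ '' N) = 0 := by
  set Q : Set Y := toMeasurable m (N ∪ Y'ᶜ ∪ {z | φ z ≠ hφ.mk φ z}) with hQ
  have hQ0 : m Q = 0 := by
    rw [hQ, measure_toMeasurable]
    refine measure_union_null (measure_union_null hN0 hY') ?_
    exact hφ.ae_eq_mk
  have hsub : N ∪ Y'ᶜ ∪ {z | φ z ≠ hφ.mk φ z} ⊆ Q := subset_toMeasurable _ _
  have hQm : MeasurableSet Q := measurableSet_toMeasurable _ _
  have hY : Qᶜ ⊆ Y' := fun z hz => by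
    by_contra h
    exact hz (hsub (Or.inl (Or.inr h)))
  have heq : EqOn (hφ.mk φ) φ Qᶜ := fun z hz => by
    by_contra h
    exact hz (hsub (Or.inr (Ne.symm h)))
  have himg : MeasurableSet (hφ.mk φ '' Qᶜ) :=
    hQm.compl.image_of_measurable_injOn hφ.measurable_mk ((hinj.mono hY).congr heq.symm)
  rw [heq.image_eq] at himg
  have hfull : m.map φ (φ '' Qᶜ)ᶜ = 0 := by
    rw [Measure.map_apply_of_aemeasurable hφ himg.compl]
    refine measure_mono_null (fun z hz => ?_) hQ0
    by_contra h
    exact hz ⟨z, h, rfl⟩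
  refine measure_mono_null ?_ hfull
  rintro _ ⟨z, hz, rfl⟩ ⟨z', hz', he⟩
  have : z' = z := hinj (hY hz') (hN hz) he
  exact hz' (this ▸ hsub (Or.inl (Or.inl hz)))

theorem nullMeasurableSet_preimage_of_aemeasurable {Y W : Type*} [MeasurableSpace Y]
    [MeasurableSpace W] {m : Measure Y} {φ : Y → W} (hφ : AEMeasurable φ m) {B : Set W}
    (hB : NullMeasurableSet B (m.map φ)) : NullMeasurableSet (φ ⁻¹' B) m := by
  have h : NullMeasurableSet (hφ.mk φ ⁻¹' B) m := by
    refine hB.preimage ⟨hφ.measurable_mk, ?_⟩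
    rw [Measure.map_congr hφ.ae_eq_mk]
  refine h.congr (eventuallyEq_set.2 ?_)
  filter_upwards [hφ.ae_eq_mk] with z hz
  simp [hz]

/-- Reduces an isomorphism to an equivariant coding that is injective on an invariant set of full
measure: taking the image measure on the target makes preservation automatic, and Lusin–Souslin
handles forward images. -/
theorem isIsomorphic_of_injOn {Y W : Type*} [MeasurableSpace Y] [StandardBorelSpace Y]
    [MeasurableSpace W] [MeasurableSpace.CountablySeparated W] {m : Measure Y} {F : Y → Y}
    {G : W → W} {φ : Y → W} (hφ : AEMeasurable φ m) {Y' : Set Y} (hY' : m Y'ᶜ = 0)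
    (hF : MapsTo F Y' Y') (hinj : InjOn φ Y') (hc : ∀ z ∈ Y', φ (F z) = G (φ z)) :
    IsIsomorphic m F (m.map φ) G := by
  have hnm : ∀ A ⊆ Y', NullMeasurableSet A m → NullMeasurableSet (φ '' A) (m.map φ) := by
    intro A hA hAm
    set Q : Set Y := toMeasurable m (Y'ᶜ ∪ {z | φ z ≠ hφ.mk φ z}) with hQ
    have hQ0 : m Q = 0 := by
      rw [hQ, measure_toMeasurable]
      exact measure_union_null hY' hφ.ae_eq_mk
    have hsub : Y'ᶜ ∪ {z | φ z ≠ hφ.mk φ z} ⊆ Q := subset_toMeasurable _ _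
    have hQm : MeasurableSet Q := measurableSet_toMeasurable _ _
    obtain ⟨A1, hA1A, hA1m, hA1⟩ := hAm.exists_measurable_subset_ae_eq
    have heq : EqOn (hφ.mk φ) φ (A1 \ Q) := fun z hz => by
      by_contra h
      exact hz.2 (hsub (Or.inr (Ne.symm h)))
    have himg : MeasurableSet (hφ.mk φ '' (A1 \ Q)) :=
      (hA1m.diff hQm).image_of_measurable_injOn hφ.measurable_mk
        ((hinj.mono ((sdiff_subset.trans hA1A).trans hA)).congr heq.symm)
    rw [heq.image_eq] at himg
    have hrest : m (A \ (A1 \ Q)) = 0 := by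
      refine measure_mono_null (t := (A \ A1) ∪ Q) ?_
        (measure_union_null (ae_le_set.1 hA1.symm.le) hQ0)
      rintro z ⟨hz, hz'⟩
      by_cases h : z ∈ A1
      · exact Or.inr (by by_contra h'; exact hz' ⟨h, h'⟩)
      · exact Or.inl ⟨hz, h⟩
    have : φ '' A = φ '' (A1 \ Q) ∪ φ '' (A \ (A1 \ Q)) := by
      rw [← image_union, union_sdiff_cancel (sdiff_subset.trans hA1A)]
    rw [this]
    exact himg.nullMeasurableSet.union_null
      (measure_image_null hφ hY' hinj (sdiff_subset.trans hA) hrest)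
  have hpre : ∀ B ⊆ φ '' Y', NullMeasurableSet B (m.map φ) →
      NullMeasurableSet (Y' ∩ φ ⁻¹' B) m ∧ m (Y' ∩ φ ⁻¹' B) = m.map φ B := by
    intro B _ hBm
    have h1 := nullMeasurableSet_preimage_of_aemeasurable hφ hBm
    refine ⟨(NullMeasurableSet.of_compl (.of_null hY')).inter h1, ?_⟩
    rw [Measure.map_apply₀ hφ hBm, inter_comm]
    exact measure_inter_conull hY'
  have hYm : NullMeasurableSet Y' m := NullMeasurableSet.of_compl (.of_null hY')
  refine ⟨Y', φ '' Y', φ, hY', ?_, hF, ?_, hinj.bijOn_image, hc, hpre, fun A hA hAm => ?_⟩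
  · rw [Measure.map_apply₀ hφ (hnm Y' Subset.rfl hYm).compl]
    refine measure_mono_null (fun z hz => ?_) hY'
    exact fun h => hz ⟨z, h, rfl⟩
  · rintro _ ⟨z, hz, rfl⟩
    exact ⟨F z, hF hz, hc z hz⟩
  · refine ⟨hnm A hA hAm, ?_⟩
    rw [← (hpre _ (image_mono hA) (hnm A hA hAm)).2]
    congr 1
    ext z
    constructor
    · rintro ⟨hz, z', hz', he⟩
      exact hinj (hA hz') hz he ▸ hz'
    · exact fun hz => ⟨hA hz, z, hz, rfl⟩

/-! ### Full branch maps -/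

/-- The map `G` with symbols `w` has full branches of constant Jacobian: given the symbol `a`, which
has probability `p {a}`, the image under `G` is distributed according to `m`. -/
structure FullBranch {X A : Type*} [MeasurableSpace X] [MeasurableSpace A] (m : Measure X)
    (w : X → A) (G : X → X) (p : Measure A) : Prop where
  preimage : ∀ E, NullMeasurableSet E m → NullMeasurableSet (G ⁻¹' E) m
  symbol : ∀ a, NullMeasurableSet (w ⁻¹' {a}) m
  branch : ∀ a E, NullMeasurableSet E m → m (w ⁻¹' {a} ∩ G ⁻¹' E) = p {a} * m E

namespace FullBranch

variable {X A : Type*} [MeasurableSpace X] [MeasurableSpace A] {m : Measure X} {w : X → A}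
  {G : X → X} {p : Measure A}

theorem nullMeasurable_iterate (h : FullBranch m w G p) {E : Set X} (hE : NullMeasurableSet E m)
    (k : ℕ) : NullMeasurableSet (G^[k] ⁻¹' E) m := by
  induction k with
  | zero => exact hE
  | succ k ih =>
    rw [Function.iterate_succ, preimage_comp]
    exact h.preimage _ ih

variable [Countable A]

theorem nullMeasurable_symbol (h : FullBranch m w G p) (t : Set A) :
    NullMeasurableSet (w ⁻¹' t) m := by
  have : w ⁻¹' t = ⋃ a ∈ t, w ⁻¹' {a} := by ext; simp
  rw [this]
  exact .biUnion (to_countable t) fun a _ => h.symbol a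

theorem aemeasurable_symbol_iterate (h : FullBranch m w G p) (k : ℕ) :
    AEMeasurable (fun x => w (G^[k] x)) m := by
  refine NullMeasurable.aemeasurable fun t _ => ?_
  exact h.nullMeasurable_iterate (h.nullMeasurable_symbol t) k

variable [DiscreteMeasurableSpace A]

theorem measure_inter (h : FullBranch m w G p) (t : Set A) {E : Set X}
    (hE : NullMeasurableSet E m) : m (w ⁻¹' t ∩ G ⁻¹' E) = p t * m E := by
  have h1 : w ⁻¹' t ∩ G ⁻¹' E = ⋃ a ∈ t, (w ⁻¹' {a} ∩ G ⁻¹' E) := by ext; simp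
  have h2 : p t = ∑' a : t, p {(a : A)} := by
    rw [← measure_biUnion (to_countable t) _ fun _ _ => .of_discrete]
    · simp
    · intro a _ b _ hab
      simpa using hab
  rw [h1, measure_biUnion₀ (to_countable t), h2, ← ENNReal.tsum_mul_right]
  · exact tsum_congr fun a => h.branch a E hE
  · intro a _ b _ hab
    refine Disjoint.aedisjoint (disjoint_left.2 ?_)
    rintro x ⟨hx, -⟩ ⟨hx', -⟩
    exact hab (hx.symm.trans hx')
  · exact fun a _ => (h.symbol a).inter (h.preimage E hE)

theorem measure_preimage [IsProbabilityMeasure p] (h : FullBranch m w G p) {E : Set X}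
    (hE : NullMeasurableSet E m) : m (G ⁻¹' E) = m E := by
  simpa using h.measure_inter univ hE

theorem ae_iterate [IsProbabilityMeasure p] (h : FullBranch m w G p) {P : X → Prop}
    (hP : ∀ᵐ x ∂m, P x) : ∀ᵐ x ∂m, ∀ n : ℕ, P (G^[n] x) := by
  refine ae_all_iff.2 fun n => ?_
  induction n with
  | zero => exact hP
  | succ n ih =>
    rw [ae_iff] at ih ⊢
    have := h.measure_preimage (.of_null ih)
    rw [ih] at this
    exact this

/-- The successive symbols are independent with law `p`: peel off the first one and apply the full
branch property to the remaining event. -/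
theorem measure_box [IsProbabilityMeasure m] (h : FullBranch m w G p) (n : ℕ) (t : ℕ → Set A) :
    NullMeasurableSet {x | ∀ k < n, w (G^[k] x) ∈ t k} m ∧
      m {x | ∀ k < n, w (G^[k] x) ∈ t k} = ∏ k ∈ Finset.range n, p (t k) := by
  induction n generalizing t with
  | zero => simp
  | succ n ih =>
    have he : {x | ∀ k < n + 1, w (G^[k] x) ∈ t k} =
        w ⁻¹' t 0 ∩ G ⁻¹' {x | ∀ k < n, w (G^[k] x) ∈ t (k + 1)} := by
      ext x
      constructor
      · intro hx
        exact ⟨hx 0 (by omega), fun k hk => hx (k + 1) (by omega)⟩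
      · rintro ⟨hx, hx'⟩ k hk
        cases k with
        | zero => exact hx
        | succ k => exact hx' k (by omega)
    obtain ⟨h1, h2⟩ := ih fun k => t (k + 1)
    rw [he, h.measure_inter _ h1, h2, Finset.prod_range_succ', mul_comm]
    exact ⟨(h.nullMeasurable_symbol _).inter (h.preimage _ h1), rfl⟩

end FullBranch

/-- The two-sided itinerary of a pair whose components code the future and the past. -/
def code {X Y A : Type*} (w : X → A) (G : X → X) (v : Y → A) (K : Y → Y) (z : X × Y) : ℤ → A
  | Int.ofNat k => w (G^[k] z.1)
  | Int.negSucc k => v (K^[k] z.2)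

/-- One step of the dynamics drops the first future symbol and makes it the most recent past symbol,
at position `-1`, which is `Int.negSucc 0`. -/
theorem shift_code {X Y A : Type*} {w : X → A} {G : X → X} {v : Y → A} {K : Y → Y} {z z' : X × Y}
    (h1 : z'.1 = G z.1) (h2 : v z'.2 = w z.1) (h3 : K z'.2 = z.2) :
    code w G v K z' = shift (code w G v K z) := by
  funext i
  rcases i with k | k
  · change w (G^[k] z'.1) = w (G^[k + 1] z.1)
    rw [h1, Function.iterate_succ_apply]
  · cases k with
    | zero => exact h2
    | succ k =>
      change v (K^[k + 1] z'.2) = v (K^[k] z.2)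
      rw [Function.iterate_succ_apply, h3]

/-! ### The law of the two-sided itinerary -/

section Code

variable {X Y A : Type*} [MeasurableSpace X] [MeasurableSpace Y] [MeasurableSpace A] [Countable A]
  {mX : Measure X} {mY : Measure Y} {p : Measure A} {w : X → A}
  {G : X → X} {v : Y → A} {K : Y → Y}

theorem aemeasurable_code (hX : FullBranch mX w G p) (hY : FullBranch mY v K p) :
    AEMeasurable (code w G v K) (mX.prod mY) := by
  refine aemeasurable_pi_iff.2 fun i => ?_
  rcases i with k | k
  · exact (hX.aemeasurable_symbol_iterate k).comp_quasiMeasurePreserving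
      Measure.quasiMeasurePreserving_fst
  · exact (hY.aemeasurable_symbol_iterate k).comp_quasiMeasurePreserving
      Measure.quasiMeasurePreserving_snd

theorem map_code [DiscreteMeasurableSpace A] [IsProbabilityMeasure mX]
    [IsProbabilityMeasure mY] [IsProbabilityMeasure p] (hX : FullBranch mX w G p) (hY : FullBranch mY v K p) :
    (mX.prod mY).map (code w G v K) = Measure.infinitePi fun _ : ℤ => p := by
  classical
  refine Measure.eq_infinitePi _ fun s t ht => ?_
  rw [Measure.map_apply_of_aemeasurable (aemeasurable_code hX hY)
    (.pi s.countable_toSet fun i _ => ht i)]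
  -- Unconstrained coordinates get `univ`, so that the box becomes a product of a future box and a
  -- past box of equal length `n`.
  set t' : ℤ → Set A := fun i => if i ∈ s then t i else univ with ht'
  set n : ℕ := s.sup Int.natAbs + 1 with hn
  have hle : ∀ i ∈ s, i.natAbs < n := fun i hi => Nat.lt_succ_of_le (Finset.le_sup hi)
  have hpre : code w G v K ⁻¹' (s : Set ℤ).pi t =
      {x | ∀ k < n, w (G^[k] x) ∈ t' (Int.ofNat k)} ×ˢ
        {y | ∀ k < n, v (K^[k] y) ∈ t' (Int.negSucc k)} := by
    ext z
    constructor
    · intro hz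
      have key : ∀ i, code w G v K z i ∈ t' i := fun i => by
        by_cases hi : i ∈ s
        · simpa [ht', hi] using hz i hi
        · simp [ht', hi]
      exact ⟨fun k _ => key (Int.ofNat k), fun k _ => key (Int.negSucc k)⟩
    · rintro ⟨h1, h2⟩ i hi
      have hi' : i ∈ s := hi
      have e : t i = t' i := by simp [ht', hi']
      rw [e]
      have := hle i hi'
      rcases i with k | k
      · exact h1 k (by simpa using this)
      · exact h2 k (by rw [Int.natAbs_negSucc] at this; omega)
  rw [hpre, Measure.prod_prod, (hX.measure_box n fun k => t' (Int.ofNat k)).2,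
    (hY.measure_box n fun k => t' (Int.negSucc k)).2]
  -- The window `{-n, …, n - 1}`; coordinates outside `s` contribute the factor one.
  set U : Finset ℤ := (Finset.range n).image Int.ofNat ∪ (Finset.range n).image Int.negSucc with hU
  have hsU : s ⊆ U := fun i hi => by
    have := hle i hi
    rw [hU, Finset.mem_union]
    rcases i with k | k
    · exact Or.inl (Finset.mem_image_of_mem _ (Finset.mem_range.2 (by simpa using this)))
    · exact Or.inr (Finset.mem_image_of_mem _
        (Finset.mem_range.2 (by rw [Int.natAbs_negSucc] at this; omega)))
  calc _ = ∏ i ∈ U, p (t' i) := by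
        rw [hU, Finset.prod_union, Finset.prod_image, Finset.prod_image]
        · exact fun a _ b _ hab => Int.negSucc.inj hab
        · exact fun a _ b _ hab => Int.ofNat.inj hab
        · refine Finset.disjoint_left.2 fun i hi hi' => ?_
          obtain ⟨a, -, rfl⟩ := Finset.mem_image.1 hi
          obtain ⟨b, -, hb⟩ := Finset.mem_image.1 hi'
          cases hb
    _ = ∏ i ∈ s, p (t' i) := by
        refine (Finset.prod_subset hsU fun i _ hi => ?_).symm
        simp [ht', hi]
    _ = ∏ i ∈ s, p (t i) := Finset.prod_congr rfl fun i hi => by simp [ht', hi]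

end Code

/-! ### Measure theory of the piecewise system -/

namespace PiecewiseSystem

variable {d : ℕ} (S : PiecewiseSystem d)

instance : IsProbabilityMeasure S.μ := S.isProb

instance : CompactSpace S.X := isCompact_iff_compactSpace.1 S.isCompact

instance : StandardBorelSpace S.X := S.isCompact.measurableSet.standardBorel

theorem measure_image_eq_zero {j : Fin S.N} {A : Set S.X} (hA : A ⊆ S.Z j) (h : S.μ A = 0) :
    S.μ (S.T '' A) = 0 := by
  rw [S.jacobian j A hA (.of_null h), h, mul_zero]

theorem ae_exists_mem : ∀ᵐ x ∂S.μ, ∃ j, x ∈ S.Z j := by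
  have := (prob_compl_eq_zero_iff (MeasurableSet.iUnion fun j => (S.isClosed j).measurableSet)).2
    S.cover
  filter_upwards [measure_eq_zero_iff_ae_notMem.1 this] with x hx
  simpa using hx

theorem ae_unique : ∀ᵐ x ∂S.μ, ∀ i j, x ∈ S.Z i → x ∈ S.Z j → i = j := by
  refine ae_all_iff.2 fun i => ae_all_iff.2 fun j => ?_
  by_cases hij : i = j
  · exact .of_forall fun _ _ _ => hij
  · filter_upwards [measure_eq_zero_iff_ae_notMem.1 (S.overlap i j hij)] with x hx h1 h2
    exact absurd ⟨h1, h2⟩ hx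

theorem ae_comp {P : S.X → Prop} (h : ∀ᵐ x ∂S.μ, P x) : ∀ᵐ x ∂S.μ, P (S.T x) := by
  rw [ae_iff] at h ⊢
  exact S.nonsingular _ h

theorem ae_iterate {P : S.X → Prop} (h : ∀ᵐ x ∂S.μ, P x) : ∀ᵐ x ∂S.μ, ∀ n : ℕ, P (S.T^[n] x) := by
  refine ae_all_iff.2 fun n => ?_
  induction n with
  | zero => exact h
  | succ n ih => exact S.ae_comp ih

theorem nullMeasurableSet_iterate {A : Set S.X} (hA : NullMeasurableSet A S.μ) (n : ℕ) :
    NullMeasurableSet (S.T^[n] ⁻¹' A) S.μ := by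
  induction n with
  | zero => exact hA
  | succ n ih => exact S.preimage_meas _ ih

theorem nullMeasurableSet_image_iterate {A : Set S.X} (hA : NullMeasurableSet A S.μ) (n : ℕ) :
    NullMeasurableSet (S.T^[n] '' A) S.μ := by
  induction n with
  | zero => simpa using hA
  | succ n ih =>
    rw [Function.iterate_succ', image_comp]
    exact S.image_meas _ ih

theorem nullMeasurableSet_cylinder {n : ℕ} (w : Fin (n + 1) → Fin S.N) :
    NullMeasurableSet (cylinder S.Z S.T w) S.μ := by
  have : cylinder S.Z S.T w = ⋂ k : Fin (n + 1), S.T^[(k : ℕ)] ⁻¹' S.Z (w k) := by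
    ext x; simp [cylinder]
  rw [this]
  exact .iInter fun k =>
    S.nullMeasurableSet_iterate (S.isClosed _).measurableSet.nullMeasurableSet k

theorem aemeasurable_T : AEMeasurable S.T S.μ :=
  NullMeasurable.aemeasurable fun _ hA => S.preimage_meas _ hA.nullMeasurableSet

/-- `A` lies in the preimage of its image, and preimages of null sets are null. -/
theorem measure_eq_zero_of_image {A : Set S.X} {n : ℕ} (h : S.μ (S.T^[n] '' A) = 0) :
    S.μ A = 0 := by
  have := S.ae_iterate (measure_eq_zero_iff_ae_notMem.1 h)
  refine measure_eq_zero_iff_ae_notMem.2 ?_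
  filter_upwards [this] with x hx hA
  exact hx n ⟨x, hA, rfl⟩

/-- The Jacobian controls images only inside one partition element, hence the condition on the
intermediate images. -/
theorem measure_image_iterate_eq_zero {A : Set S.X} {n : ℕ}
    (hA : ∀ k < n, ∃ j, S.T^[k] '' A ⊆ S.Z j) (h : S.μ A = 0) : S.μ (S.T^[n] '' A) = 0 := by
  induction n with
  | zero => simpa using h
  | succ n ih =>
    rw [Function.iterate_succ', image_comp]
    obtain ⟨j, hj⟩ := hA n (by omega)
    exact S.measure_image_eq_zero hj (ih fun k hk => hA k (by omega))

theorem image_ae_eq {A B : Set S.X} {i j : Fin S.N} (hA : A ⊆ S.Z i) (hB : B ⊆ S.Z j)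
    (h : A =ᵐ[S.μ] B) : (S.T '' A : Set S.X) =ᵐ[S.μ] (S.T '' B : Set S.X) := by
  rw [ae_eq_set] at h ⊢
  refine ⟨measure_mono_null (t := S.T '' (A \ B)) ?_
      (S.measure_image_eq_zero (sdiff_subset.trans hA) h.1),
    measure_mono_null (t := S.T '' (B \ A)) ?_
      (S.measure_image_eq_zero (sdiff_subset.trans hB) h.2)⟩
  · rintro _ ⟨⟨x, hx, rfl⟩, hx'⟩
    exact ⟨x, ⟨hx, fun h => hx' ⟨x, h, rfl⟩⟩, rfl⟩
  · rintro _ ⟨⟨x, hx, rfl⟩, hx'⟩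
    exact ⟨x, ⟨hx, fun h => hx' ⟨x, h, rfl⟩⟩, rfl⟩

theorem cylinder_snoc {n : ℕ} (w : Fin (n + 1) → Fin S.N) (j : Fin S.N) :
    cylinder S.Z S.T (Fin.snoc w j : Fin (n + 2) → Fin S.N) =
      cylinder S.Z S.T w ∩ S.T^[n + 1] ⁻¹' S.Z j := by
  ext x
  simp only [cylinder, mem_ofPred_eq, mem_inter_iff, mem_preimage]
  constructor
  · intro h
    refine ⟨fun k => ?_, ?_⟩
    · simpa using h k.castSucc
    · simpa using h (Fin.last _)
  · rintro ⟨h1, h2⟩ k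
    refine Fin.lastCases ?_ (fun k => ?_) k
    · simpa using h2
    · simpa using h1 k

theorem image_cylinder_subset {n : ℕ} (w : Fin (n + 1) → Fin S.N) (k : Fin (n + 1)) :
    S.T^[(k : ℕ)] '' cylinder S.Z S.T w ⊆ S.Z (w k) := by
  rintro _ ⟨x, hx, rfl⟩
  exact hx k

end PiecewiseSystem

/-! ### The canonical Markov graph -/

namespace Tower

variable {d : ℕ} {S : PiecewiseSystem d} (H : Tower S)

theorem nullMeasurableSet_D {u : ℕ} (hu : u ∈ H.α) : NullMeasurableSet (H.D u) S.μ := by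
  obtain ⟨n, w, -, h⟩ := H.is_image u hu
  exact (S.nullMeasurableSet_image_iterate (S.nullMeasurableSet_cylinder w) n).congr h.symm

theorem measure_D_pos {u : ℕ} (hu : u ∈ H.α) : 0 < S.μ (H.D u) := by
  obtain ⟨n, w, hw, h⟩ := H.is_image u hu
  rw [measure_congr h]
  refine pos_iff_ne_zero.2 fun h0 => hw.ne' (S.measure_eq_zero_of_image h0)

theorem s_ne_zero (j : Fin S.N) : (S.s j : ℝ≥0∞) ≠ 0 := by
  have := S.one_le_s j
  exact_mod_cast (zero_lt_one.trans_le this).ne'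

variable {H}

theorem ArrowVia.branch_eq {t v : ℕ} {j : Fin S.N} (h : H.ArrowVia t j v) (hv : v ∈ H.α) :
    H.branch v = j := by
  by_contra hne
  refine (H.measure_D_pos hv).ne' ?_
  refine measure_mono_null_ae ?_ (S.overlap _ _ hne)
  filter_upwards [eventuallyEq_set.1 h.2] with x hx hxD
  exact ⟨H.subset v hv hxD, (hx.1 hxD).1⟩

theorem ArrowVia.eq {t v v' : ℕ} {j : Fin S.N} (h : H.ArrowVia t j v) (h' : H.ArrowVia t j v')
    (hv : v ∈ H.α) (hv' : v' ∈ H.α) : v = v' :=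
  H.distinct v hv v' hv' (h.2.trans h'.2.symm)

/-- If `D t` is the `n`-th image of a cylinder, then `Z j ∩ T (D t)` is the next image of that
cylinder extended by the symbol `j`. The extended cylinder is not null because its image is not, so
`exhaust` supplies a level. -/
theorem exists_arrowVia {t : ℕ} (ht : t ∈ H.α) {j : Fin S.N}
    (h : 0 < S.μ (S.Z j ∩ S.T '' H.D t)) : ∃ v ∈ H.α, H.ArrowVia t j v := by
  obtain ⟨n, w, hw, he⟩ := H.is_image t ht
  have hcyl : S.T^[n] '' cylinder S.Z S.T w ⊆ S.Z (w (Fin.last n)) := by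
    simpa using S.image_cylinder_subset w (Fin.last n)
  have h1 := S.image_ae_eq (H.subset t ht) hcyl he
  have h2 : S.T^[n + 1] '' cylinder S.Z S.T (Fin.snoc w j : Fin (n + 2) → Fin S.N) =
      S.Z j ∩ S.T '' (S.T^[n] '' cylinder S.Z S.T w) := by
    rw [S.cylinder_snoc, image_inter_preimage, inter_comm, Function.iterate_succ', image_comp]
  have h3 : (S.Z j ∩ S.T '' H.D t : Set S.X) =ᵐ[S.μ]
      (S.T^[n + 1] '' cylinder S.Z S.T (Fin.snoc w j : Fin (n + 2) → Fin S.N) : Set S.X) := by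
    rw [h2]
    exact (ae_eq_refl _).inter h1
  have h4 : 0 < S.μ (cylinder S.Z S.T (Fin.snoc w j : Fin (n + 2) → Fin S.N)) := by
    refine pos_iff_ne_zero.2 fun h0 => h.ne' ?_
    rw [measure_congr h3]
    refine S.measure_image_iterate_eq_zero (fun k hk => ?_) h0
    exact ⟨_, S.image_cylinder_subset (Fin.snoc w j : Fin (n + 2) → Fin S.N) ⟨k, by omega⟩⟩
  obtain ⟨v, hv, hv'⟩ := H.exhaust _ _ h4
  exact ⟨v, hv, h, hv'.trans h3.symm⟩

theorem nextLevel_eq {t v : ℕ} {j : Fin S.N} {x : S.X}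
    (hx : ∀ i j, S.T x ∈ S.Z i → S.T x ∈ S.Z j → i = j) (hxj : S.T x ∈ S.Z j)
    (h : H.ArrowVia t j v) (hv : v ∈ H.α) : H.nextLevel x t = v := by
  have hex : ∃ v ∈ H.α, ∃ j, S.T x ∈ S.Z j ∧ H.ArrowVia t j v := ⟨v, hv, j, hxj, h⟩
  rw [nextLevel, dif_pos hex]
  obtain ⟨h1, i, h2, h3⟩ := hex.choose_spec
  obtain rfl := hx i j h2 hxj
  exact h3.eq h h1 hv

variable (H)

theorem ae_exists_arrowVia {t : ℕ} (ht : t ∈ H.α) : ∀ᵐ x ∂S.μ, x ∈ H.D t →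
    ∃ v ∈ H.α, ∃ j, S.T x ∈ S.Z j ∧ H.ArrowVia t j v ∧ H.nextLevel x t = v ∧ S.T x ∈ H.D v := by
  have h1 : ∀ᵐ x ∂S.μ, ∀ j, S.μ (S.Z j ∩ S.T '' H.D t) = 0 → x ∉ S.Z j ∩ S.T '' H.D t := by
    refine ae_all_iff.2 fun j => ?_
    by_cases h : S.μ (S.Z j ∩ S.T '' H.D t) = 0
    · filter_upwards [measure_eq_zero_iff_ae_notMem.1 h] with x hx _ using hx
    · exact .of_forall fun _ h' => absurd h' h
  have h2 : ∀ᵐ x ∂S.μ, ∀ v j, H.ArrowVia t j v → x ∈ S.Z j ∩ S.T '' H.D t → x ∈ H.D v := by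
    refine ae_all_iff.2 fun v => ae_all_iff.2 fun j => ?_
    by_cases h : H.ArrowVia t j v
    · filter_upwards [eventuallyEq_set.1 h.2] with x hx _ using hx.2
    · exact .of_forall fun _ h' => absurd h' h
  filter_upwards [S.ae_comp S.ae_exists_mem, S.ae_comp S.ae_unique, S.ae_comp h1, S.ae_comp h2]
    with x hx1 hx2 hx3 hx4 hxD
  obtain ⟨j, hj⟩ := hx1
  have hmem : S.T x ∈ S.Z j ∩ S.T '' H.D t := ⟨hj, x, hxD, rfl⟩
  obtain ⟨v, hv, hvj⟩ := exists_arrowVia ht (pos_iff_ne_zero.2 fun h0 => hx3 j h0 hmem)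
  exact ⟨v, hv, j, hj, hvj, nextLevel_eq hx2 hj hvj hv, hx4 v j hvj hmem⟩

theorem ae_nextLevel {t : ℕ} (ht : t ∈ H.α) : ∀ᵐ x ∂S.μ, x ∈ H.D t →
    H.nextLevel x t ∈ H.α ∧ H.Arrow t (H.nextLevel x t) ∧ S.T x ∈ H.D (H.nextLevel x t) := by
  filter_upwards [H.ae_exists_arrowVia ht] with x hx hxD
  obtain ⟨v, hv, j, -, hvj, rfl, h⟩ := hx hxD
  exact ⟨hv, ⟨j, hvj⟩, h⟩

-- Modulo null sets the points of `D t` moving to `D v` are those with `T x ∈ Z j`, and `T` carries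
-- them onto `D v`. The constant Jacobian on `Z (branch t)` then gives the measure.
open Classical in
theorem measure_branch {t v : ℕ} (ht : t ∈ H.α) (hv : v ∈ H.α) {E : Set S.X}
    (hE : NullMeasurableSet E S.μ) :
    NullMeasurableSet {x | x ∈ H.D t ∧ H.nextLevel x t = v ∧ S.T x ∈ E} S.μ ∧
    S.μ {x | x ∈ H.D t ∧ H.nextLevel x t = v ∧ S.T x ∈ E} =
      if H.Arrow t v then S.μ (H.D v ∩ E) / S.s (H.branch t) else 0 := by
  split_ifs with harrow
  · obtain ⟨j, hj⟩ := harrow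
    set A : Set S.X := H.D t ∩ S.T ⁻¹' (S.Z j ∩ E) with hA
    have hAm : NullMeasurableSet A S.μ := (H.nullMeasurableSet_D ht).inter
      (S.preimage_meas _ ((S.isClosed j).measurableSet.nullMeasurableSet.inter hE))
    have hae : {x | x ∈ H.D t ∧ H.nextLevel x t = v ∧ S.T x ∈ E} =ᵐ[S.μ] A := by
      refine eventuallyEq_set.2 ?_
      filter_upwards [H.ae_exists_arrowVia ht, S.ae_comp S.ae_unique] with x hx hx2
      constructor
      · rintro ⟨h1, h2, h3⟩
        obtain ⟨v', hv', i, hi, hvi, h4, -⟩ := hx h1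
        obtain rfl : v = v' := h2.symm.trans h4
        obtain rfl : i = j := (hvi.branch_eq hv).symm.trans (hj.branch_eq hv)
        exact ⟨h1, hi, h3⟩
      · rintro ⟨h1, h2, h3⟩
        exact ⟨h1, nextLevel_eq hx2 h2 hj hv, h3⟩
    refine ⟨hAm.congr hae.symm, ?_⟩
    have hTA : S.μ (S.T '' A) = S.μ (H.D v ∩ E) := by
      rw [hA, image_inter_preimage]
      refine measure_congr ?_
      rw [← inter_assoc, inter_comm (S.T '' H.D t)]
      exact hj.2.symm.inter (ae_eq_refl _)
    rw [measure_congr hae, ← hTA,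
      S.jacobian _ A (inter_subset_left.trans (H.subset t ht)) hAm, mul_comm,
      ENNReal.mul_div_cancel_right (s_ne_zero _) ENNReal.coe_ne_top]
  · have : S.μ {x | x ∈ H.D t ∧ H.nextLevel x t = v ∧ S.T x ∈ E} = 0 := by
      refine measure_eq_zero_iff_ae_notMem.2 ?_
      filter_upwards [H.ae_nextLevel ht] with x hx h
      exact harrow (h.2.1 ▸ (hx h.1).2.1)
    exact ⟨.of_null this, this⟩

/-! ### Measures with constant densities on the levels -/

/-- The measure on the tower with the constant density `c v` on the level `D v`. -/
def weighted (c : ℕ → ℝ≥0∞) : Measure (S.X × ℕ) :=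
  Measure.sum fun v : H.α => c v • (S.μ.restrict (H.D v)).map fun x => (x, (v : ℕ))

open Classical in
/-- The transfer operator of the tower map on densities that are constant on the levels. -/
def transfer (c : ℕ → ℝ≥0∞) (v : ℕ) : ℝ≥0∞ :=
  ∑' t : H.α, if H.Arrow t v then c t / S.s (H.branch t) else 0

theorem muBar_eq : H.muBar = H.weighted 1 := by simp [muBar, weighted]

theorem weighted_apply (c : ℕ → ℝ≥0∞) {E : Set (S.X × ℕ)} (hE : MeasurableSet E) :
    H.weighted c E = ∑' v : H.α, c v * S.μ (H.D v ∩ {x | (x, (v : ℕ)) ∈ E}) := by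
  rw [weighted, Measure.sum_apply _ hE]
  refine tsum_congr fun v => ?_
  have hm : Measurable fun x : S.X => (x, (v : ℕ)) := by fun_prop
  rw [Measure.smul_apply, smul_eq_mul, Measure.map_apply hm hE,
    Measure.restrict_apply (hm hE), inter_comm]
  rfl

theorem weighted_absolutelyContinuous (c : ℕ → ℝ≥0∞) : H.weighted c ≪ H.muBar := by
  rw [muBar_eq]
  refine Measure.AbsolutelyContinuous.mk fun E hE h => ?_
  rw [weighted_apply _ _ hE] at h ⊢
  rw [ENNReal.tsum_eq_zero] at h ⊢
  intro v
  have := h v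
  simp only [Pi.one_apply, one_mul] at this
  rw [this, mul_zero]

theorem measurableEmbedding_mk {X : Type*} [MeasurableSpace X] (v : ℕ) :
    MeasurableEmbedding fun x : X => (x, v) :=
  .of_measurable_inverse (g := Prod.fst) (by fun_prop)
    (by
      have : range (fun x : X => (x, v)) = Prod.snd ⁻¹' {v} := by
        ext ⟨x, n⟩; simp [eq_comm]
      rw [this]
      exact measurable_snd (measurableSet_singleton v)) measurable_fst fun _ => rfl

theorem ae_muBar_iff {P : S.X × ℕ → Prop} :
    (∀ᵐ p ∂H.muBar, P p) ↔ ∀ v ∈ H.α, ∀ᵐ x ∂S.μ, x ∈ H.D v → P (x, v) := by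
  rw [muBar, Measure.ae_sum_iff, Subtype.forall]
  refine forall₂_congr fun v hv => ?_
  rw [(measurableEmbedding_mk v).ae_map_iff, ae_restrict_iff'₀ (H.nullMeasurableSet_D hv)]

theorem aemeasurable_nextLevel {t : ℕ} (ht : t ∈ H.α) :
    AEMeasurable (fun x => H.nextLevel x t) (S.μ.restrict (H.D t)) := by
  have hD := H.nullMeasurableSet_D ht
  have hin : ∀ v ∈ H.α, NullMeasurableSet ((fun x => H.nextLevel x t) ⁻¹' {v})
      (S.μ.restrict (H.D t)) := fun v hv => by
    have := (H.measure_branch ht hv (nullMeasurableSet_univ (μ := S.μ))).1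
    refine (this.mono_ac Measure.restrict_le_self.absolutelyContinuous).congr ?_
    refine eventuallyEq_set.2 ?_
    filter_upwards [ae_restrict_mem₀ hD] with x hx
    simp [hx]
  have hout : ∀ v ∉ H.α, NullMeasurableSet ((fun x => H.nextLevel x t) ⁻¹' {v})
      (S.μ.restrict (H.D t)) := fun v hv => by
    refine .of_null (measure_eq_zero_iff_ae_notMem.2 ?_)
    rw [ae_restrict_iff'₀ hD]
    filter_upwards [H.ae_nextLevel ht] with x hx hxD hv'
    exact hv (hv' ▸ (hx hxD).1)
  refine NullMeasurable.aemeasurable fun A _ => ?_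
  rw [← biUnion_of_singleton A, preimage_iUnion₂]
  refine .biUnion (to_countable A) fun v _ => ?_
  by_cases hv : v ∈ H.α
  exacts [hin v hv, hout v hv]

theorem aemeasurable_towerMap : AEMeasurable H.towerMap H.muBar := by
  rw [muBar, aemeasurable_sum_measure_iff]
  intro t
  rw [(measurableEmbedding_mk (t : ℕ)).aemeasurable_map_iff]
  exact S.aemeasurable_T.restrict.prodMk (H.aemeasurable_nextLevel t.2)

theorem aemeasurable_towerMap_weighted (c : ℕ → ℝ≥0∞) : AEMeasurable H.towerMap (H.weighted c) :=
  H.aemeasurable_towerMap.mono_ac (H.weighted_absolutelyContinuous c)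

theorem measure_preimage_level {t : ℕ} (ht : t ∈ H.α) {E : Set (S.X × ℕ)} (hE : MeasurableSet E) :
    S.μ (H.D t ∩ {x | H.towerMap (x, t) ∈ E}) =
      ∑' v : H.α, S.μ {x | x ∈ H.D t ∧ H.nextLevel x t = v ∧ S.T x ∈ {y | (y, (v : ℕ)) ∈ E}} := by
  have hm : ∀ v : H.α, NullMeasurableSet {y : S.X | (y, (v : ℕ)) ∈ E} S.μ := fun v =>
    ((by fun_prop : Measurable fun y : S.X => (y, (v : ℕ))) hE).nullMeasurableSet
  rw [← measure_iUnion₀]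
  · refine measure_congr (eventuallyEq_set.2 ?_)
    filter_upwards [H.ae_nextLevel ht] with x hx
    constructor
    · rintro ⟨h1, h2⟩
      exact mem_iUnion.2 ⟨⟨_, (hx h1).1⟩, h1, rfl, h2⟩
    · intro h
      obtain ⟨v, h1, h2, h3⟩ := mem_iUnion.1 h
      refine ⟨h1, ?_⟩
      change (S.T x, H.nextLevel x t) ∈ E
      rw [h2]
      exact h3
  · intro v v' hne
    refine Disjoint.aedisjoint (disjoint_left.2 ?_)
    rintro x ⟨-, h, -⟩ ⟨-, h', -⟩
    exact hne (Subtype.ext (h.symm.trans h'))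
  · exact fun v => (H.measure_branch ht v.2 (hm v)).1

/-- Measures with constant density on each level are closed under the tower map, because every
branch covers its whole target level with constant Jacobian. The dynamics of such measures thus
reduces to a countable matrix. -/
theorem map_weighted (c : ℕ → ℝ≥0∞) :
    (H.weighted c).map H.towerMap = H.weighted (H.transfer c) := by
  classical
  ext E hE
  have hm : ∀ v : H.α, NullMeasurableSet {y : S.X | (y, (v : ℕ)) ∈ E} S.μ := fun v =>
    ((by fun_prop : Measurable fun y : S.X => (y, (v : ℕ))) hE).nullMeasurableSet
  have hsum : (H.weighted c).map H.towerMap E =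
      ∑' t : H.α, c t * S.μ (H.D t ∩ {x | H.towerMap (x, (t : ℕ)) ∈ E}) := by
    have hae := H.aemeasurable_towerMap_weighted c
    rw [weighted, Measure.map_sum hae, Measure.sum_apply _ hE]
    refine tsum_congr fun t => ?_
    have hmt : Measurable fun x : S.X => (x, (t : ℕ)) := by fun_prop
    have h1 : AEMeasurable H.towerMap ((S.μ.restrict (H.D t)).map fun x => (x, (t : ℕ))) := by
      have := H.aemeasurable_towerMap
      rw [muBar, aemeasurable_sum_measure_iff] at this
      exact this t
    rw [Measure.map_smul, Measure.smul_apply, smul_eq_mul,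
      AEMeasurable.map_map_of_aemeasurable h1 hmt.aemeasurable,
      Measure.map_apply_of_aemeasurable (h1.comp_aemeasurable hmt.aemeasurable) hE,
      Measure.restrict_apply₀ ((h1.comp_aemeasurable hmt.aemeasurable).nullMeasurable hE),
      inter_comm]
    rfl
  rw [hsum, weighted_apply _ _ hE]
  simp_rw [H.measure_preimage_level (Subtype.prop _) hE, ← ENNReal.tsum_mul_left]
  rw [ENNReal.tsum_comm]
  refine tsum_congr fun v => ?_
  rw [transfer, ← ENNReal.tsum_mul_right]
  refine tsum_congr fun t => ?_
  rw [(H.measure_branch t.2 v.2 (hm v)).2]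
  split_ifs
  · simp only [div_eq_mul_inv]
    ring
  · simp

theorem ae_muBar_iterate {P : S.X × ℕ → Prop} (h : ∀ᵐ p ∂H.muBar, P p) :
    ∀ᵐ p ∂H.muBar, ∀ n : ℕ, P (H.towerMap^[n] p) := by
  refine ae_all_iff.2 fun n => ?_
  induction n with
  | zero => exact h
  | succ n ih =>
    have h1 : ∀ᵐ p ∂H.muBar.map H.towerMap, P (H.towerMap^[n] p) := by
      refine Measure.AbsolutelyContinuous.ae_le ?_ ih
      conv_lhs => rw [muBar_eq, map_weighted]
      exact H.weighted_absolutelyContinuous _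
    filter_upwards [ae_of_ae_map H.aemeasurable_towerMap h1] with p hp using hp

end Tower

/-- Poincaré recurrence for an almost everywhere measurable map. -/
theorem ae_frequently_of_map_eq {Y : Type*} [MeasurableSpace Y] {M : Measure Y} [IsFiniteMeasure M]
    {f : Y → Y} (hf : AEMeasurable f M) (hM : M.map f = M) {s : Set Y}
    (hs : NullMeasurableSet s M) : ∀ᵐ p ∂M, p ∈ s → ∃ᶠ n in atTop, f^[n] p ∈ s := by
  have hg : MeasurePreserving (hf.mk f) M M :=
    ⟨hf.measurable_mk, by rw [← Measure.map_congr hf.ae_eq_mk, hM]⟩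
  -- Almost every orbit avoids the set where `f` differs from its measurable version, so the two
  -- orbits coincide.
  have h1 : ∀ᵐ p ∂M, ∀ n : ℕ, f ((hf.mk f)^[n] p) = hf.mk f ((hf.mk f)^[n] p) :=
    ae_all_iff.2 fun n => (hg.iterate n).quasiMeasurePreserving.ae hf.ae_eq_mk
  filter_upwards [h1, hg.conservative.ae_mem_imp_frequently_image_mem hs] with p hp hp' hps
  have h2 : ∀ n : ℕ, f^[n] p = (hf.mk f)^[n] p := fun n => by
    induction n with
    | zero => rfl
    | succ n ih => rw [Function.iterate_succ_apply', Function.iterate_succ_apply', ih, hp n]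
  simpa only [h2] using hp' hps

/-! ### Densities of the Cesàro means -/

namespace Tower

variable {d : ℕ} {S : PiecewiseSystem d} (H : Tower S)

/-- The copy of `X` that contains the level `D v`. -/
def sheet (S : PiecewiseSystem d) (v : ℕ) : Set (S.X × ℕ) := univ ×ˢ {v}

theorem measurableSet_sheet (v : ℕ) : MeasurableSet (sheet S v) :=
  MeasurableSet.univ.prod (measurableSet_singleton v)

theorem isCompact_sheet (v : ℕ) : IsCompact (sheet S v) := isCompact_univ.prod isCompact_singleton

theorem weighted_sheet (c : ℕ → ℝ≥0∞) {v : ℕ} (hv : v ∈ H.α) :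
    H.weighted c (sheet S v) = c v * S.μ (H.D v) := by
  rw [weighted_apply _ _ (measurableSet_sheet v), tsum_eq_single ⟨v, hv⟩]
  · congr 2
    ext x
    simp [sheet]
  · intro w hw
    have : H.D w ∩ {x | (x, (w : ℕ)) ∈ sheet S v} = ∅ := by
      ext x
      have : (w : ℕ) ≠ v := fun h => hw (Subtype.ext h)
      simp [sheet, this]
    rw [this, measure_empty, mul_zero]

theorem weighted_univ (c : ℕ → ℝ≥0∞) :
    H.weighted c univ = ∑' v : H.α, c v * S.μ (H.D v) := by
  rw [weighted_apply _ _ .univ]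
  refine tsum_congr fun v => ?_
  congr 2
  ext x
  simp

theorem map_iterate_weighted (c : ℕ → ℝ≥0∞) (k : ℕ) :
    AEMeasurable H.towerMap^[k] (H.weighted c) ∧
      (H.weighted c).map H.towerMap^[k] = H.weighted (H.transfer^[k] c) := by
  induction k with
  | zero => exact ⟨aemeasurable_id, by simp⟩
  | succ k ih =>
    have h1 : AEMeasurable H.towerMap ((H.weighted c).map H.towerMap^[k]) := by
      rw [ih.2]
      exact H.aemeasurable_towerMap_weighted _
    rw [Function.iterate_succ']
    refine ⟨h1.comp_aemeasurable ih.1, ?_⟩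
    rw [← AEMeasurable.map_map_of_aemeasurable h1 ih.1, ih.2, map_weighted,
      Function.iterate_succ_apply']

theorem weighted_transfer_univ (c : ℕ → ℝ≥0∞) :
    H.weighted (H.transfer c) univ = H.weighted c univ := by
  rw [← map_weighted, Measure.map_apply_of_aemeasurable (H.aemeasurable_towerMap_weighted c) .univ,
    preimage_univ]

theorem weighted_iterate_univ (c : ℕ → ℝ≥0∞) (k : ℕ) :
    H.weighted (H.transfer^[k] c) univ = H.weighted c univ := by
  induction k with
  | zero => rfl
  | succ k ih => rw [Function.iterate_succ_apply', weighted_transfer_univ, ih]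

theorem density_mul_le (c : ℕ → ℝ≥0∞) {v : ℕ} (hv : v ∈ H.α) :
    c v * S.μ (H.D v) ≤ H.weighted c univ := by
  rw [← weighted_sheet H c hv]
  exact measure_mono (subset_univ _)

/-- The density of the restriction of `muBar` to the base. -/
def baseDensity : ℕ → ℝ≥0∞ := indicator {u | u ∈ H.α ∧ ∃ j, H.D u =ᵐ[S.μ] S.Z j} 1

theorem restrict_base : H.muBar.restrict H.base = H.weighted H.baseDensity := by
  classical
  set I : Set ℕ := {u | u ∈ H.α ∧ ∃ j, H.D u =ᵐ[S.μ] S.Z j} with hI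
  have h1 : H.base =ᵐ[H.muBar] (univ ×ˢ I : Set (S.X × ℕ)) := by
    refine eventuallyEq_set.2 ?_
    rw [H.ae_muBar_iff]
    refine fun v hv => .of_forall fun x hx => ?_
    constructor
    · intro h
      obtain ⟨u, hu, h1, -⟩ := mem_iUnion₂.1 h
      exact ⟨trivial, show v ∈ I from (show v = u from h1) ▸ hu⟩
    · rintro ⟨-, h⟩
      exact mem_iUnion₂.2 ⟨v, h, rfl, hx⟩
  have hIm : MeasurableSet (univ ×ˢ I : Set (S.X × ℕ)) := MeasurableSet.univ.prod .of_discrete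
  rw [Measure.restrict_congr_set h1]
  ext E hE
  rw [Measure.restrict_apply hE, muBar_eq, weighted_apply _ _ (hE.inter hIm),
    weighted_apply _ _ hE]
  refine tsum_congr fun v => ?_
  by_cases hv : (v : ℕ) ∈ I
  · simp [baseDensity, ← hI, hv]
  · simp [baseDensity, ← hI, hv]

/-- Distinct levels are not equal modulo null sets, so each `Z j` accounts for at most one base
level and the base is a finite union. -/
theorem weighted_baseDensity_ne_top : H.weighted H.baseDensity univ ≠ ⊤ := by
  classical
  set I : Set ℕ := {u | u ∈ H.α ∧ ∃ j, H.D u =ᵐ[S.μ] S.Z j} with hI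
  have hfin : I.Finite := by
    -- `choose!` needs a default partition index; with no partition element the base is empty.
    rcases isEmpty_or_nonempty (Fin S.N) with hN | hN
    · have : I = ∅ := eq_empty_of_forall_notMem fun u hu => hN.elim hu.2.choose
      rw [this]
      exact finite_empty
    choose! f hf using fun u (hu : u ∈ I) => hu.2
    refine Set.Finite.of_finite_image (f := f) (toFinite _) ?_
    intro u hu v hv huv
    have h := hf v hv
    rw [← show f u = f v from huv] at h
    exact H.distinct u hu.1 v hv.1 ((hf u hu).trans h.symm)
  have hle : H.weighted H.baseDensity univ ≤ ∑' v : ℕ, I.indicator 1 v := by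
    rw [weighted_univ]
    refine (ENNReal.tsum_le_tsum fun v => ?_).trans
      (ENNReal.tsum_comp_le_tsum_of_injective Subtype.val_injective (I.indicator 1))
    change I.indicator 1 (v : ℕ) * S.μ (H.D v) ≤ I.indicator 1 (v : ℕ)
    exact mul_le_of_le_one_right' prob_le_one
  refine ne_top_of_le_ne_top ?_ hle
  rw [tsum_eq_sum (s := hfin.toFinset)]
  · refine (ENNReal.sum_lt_top.2 fun v _ => ?_).ne
    by_cases hv : v ∈ I <;> simp [hv]
  · intro v hv
    simpa using hv

/-- The density of the `n`-th Cesàro mean. -/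
def cesaroDensity (n v : ℕ) : ℝ≥0∞ :=
  (n : ℝ≥0∞)⁻¹ * ∑ k ∈ Finset.range n, H.transfer^[k] H.baseDensity v

theorem cesaro_sheet (n : ℕ) {v : ℕ} (hv : v ∈ H.α) :
    H.cesaro n (sheet S v) = H.cesaroDensity n v * S.μ (H.D v) := by
  simp only [cesaro, restrict_base, (H.map_iterate_weighted _ _).2, Measure.smul_apply,
    Measure.finsetSum_apply, weighted_sheet _ _ hv, smul_eq_mul, cesaroDensity, mul_assoc,
    Finset.sum_mul]

theorem sum_cesaroDensity_le (n : ℕ) (s : Finset H.α) :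
    ∑ v ∈ s, H.cesaroDensity n v * S.μ (H.D v) ≤ H.weighted H.baseDensity univ := by
  have h1 : ∑ v ∈ s, H.cesaroDensity n v * S.μ (H.D v) = (n : ℝ≥0∞)⁻¹ *
      ∑ k ∈ Finset.range n, ∑ v ∈ s, H.transfer^[k] H.baseDensity v * S.μ (H.D v) := by
    simp only [cesaroDensity, mul_assoc, Finset.sum_mul, ← Finset.mul_sum]
    rw [Finset.sum_comm]
  have h2 : ∀ k ∈ Finset.range n, ∑ v ∈ s, H.transfer^[k] H.baseDensity v * S.μ (H.D v) ≤
      H.weighted H.baseDensity univ := fun k _ => by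
    rw [← weighted_iterate_univ H _ k, weighted_univ]
    exact ENNReal.sum_le_tsum s
  rw [h1]
  refine (mul_le_mul_right (Finset.sum_le_sum h2) _).trans ?_
  rw [Finset.sum_const, Finset.card_range, nsmul_eq_mul, ← mul_assoc]
  exact mul_le_of_le_one_left' (ENNReal.inv_mul_le_one _)

theorem cesaroDensity_mul_le (n : ℕ) {v : ℕ} (hv : v ∈ H.α) :
    H.cesaroDensity n v * S.μ (H.D v) ≤ H.weighted H.baseDensity univ := by
  simpa using H.sum_cesaroDensity_le n {⟨v, hv⟩}

-- Applying the transfer operator to a Cesàro mean shifts its sum by one index, so the excess over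
-- the mean is at most the last term divided by `n`. Finite partial sums are used so that the limit
-- can be taken termwise.
open Classical in
theorem sum_transfer_cesaroDensity_le (n v : ℕ) (s : Finset H.α) :
    ∑ t ∈ s, (if H.Arrow t v then H.cesaroDensity n t / S.s (H.branch t) else 0) ≤
      H.cesaroDensity n v + (n : ℝ≥0∞)⁻¹ * H.transfer^[n] H.baseDensity v := by
  have h1 : ∑ t ∈ s, (if H.Arrow t v then H.cesaroDensity n t / S.s (H.branch t) else 0) =
      (n : ℝ≥0∞)⁻¹ * ∑ k ∈ Finset.range n, ∑ t ∈ s,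
        (if H.Arrow t v then H.transfer^[k] H.baseDensity t / S.s (H.branch t) else 0) := by
    rw [Finset.sum_comm, Finset.mul_sum]
    refine Finset.sum_congr rfl fun t _ => ?_
    split_ifs
    · simp only [cesaroDensity, div_eq_mul_inv, mul_assoc, Finset.sum_mul]
    · simp
  have h2 : ∀ k ∈ Finset.range n, ∑ t ∈ s,
      (if H.Arrow t v then H.transfer^[k] H.baseDensity t / S.s (H.branch t) else 0) ≤
      H.transfer^[k + 1] H.baseDensity v := fun k _ => by
    rw [Function.iterate_succ_apply']
    exact ENNReal.sum_le_tsum s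
  rw [h1, cesaroDensity, ← mul_add, ← Finset.sum_range_succ, Finset.sum_range_succ']
  exact mul_le_mul_right ((Finset.sum_le_sum h2).trans le_self_add) _

/-! ### The invariant density -/

/-- The density of the lift, as an extended non-negative number. -/
def density (μhat : Measure (S.X × ℕ)) (v : ℕ) : ℝ≥0∞ := μhat (H.level v) / S.μ (H.D v)

variable {μhat : Measure (S.X × ℕ)}

theorem rho_eq (v : ℕ) : H.rho μhat v = (H.density μhat v).toReal := by
  rw [rho, density, ENNReal.toReal_div]

theorem density_mul {v : ℕ} (hv : v ∈ H.α) :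
    H.density μhat v * S.μ (H.D v) = μhat (H.level v) :=
  ENNReal.div_mul_cancel (H.measure_D_pos hv).ne' (measure_ne_top _ _)

variable {H}

namespace IsLift

variable (h : H.IsLift μhat)
include h

theorem measure_sheet (v : ℕ) : μhat (sheet S v) = μhat (H.level v) := by
  refine le_antisymm ?_ (measure_mono fun p hp => ⟨trivial, hp.1⟩)
  refine (measure_mono (t := H.level v ∪ H.carrierᶜ) fun p hp => ?_).trans
    ((measure_union_le _ _).trans (by rw [h.on_tower, add_zero]))
  by_cases hc : p ∈ H.carrier
  · obtain ⟨u, hu, hpu⟩ := mem_iUnion₂.1 hc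
    have : p.2 = v := hp.2
    exact Or.inl (by rwa [← hpu.1, this] at hpu)
  · exact Or.inr hc

theorem measure_level_lt_top (v : ℕ) : μhat (H.level v) < ⊤ := by
  have := h.finite_on_compacts
  rw [← h.measure_sheet v]
  exact (isCompact_sheet v).measure_lt_top

/-- Each copy of `X` is compact and open, so its indicator is an admissible test function; vague
convergence therefore gives convergence of the masses of the levels. -/
theorem tendsto_cesaro_sheet {v : ℕ} (hv : v ∈ H.α) :
    Tendsto (fun n => H.cesaro n (sheet S v)) atTop (𝓝 (μhat (H.level v))) := by
  have hopen : IsOpen (sheet S v) := isOpen_univ.prod (isOpen_discrete _)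
  have hcl : IsClopen (sheet S v) := ⟨(isCompact_sheet v).isClosed, hopen⟩
  have hf : Continuous ((sheet S v).indicator (1 : S.X × ℕ → ℝ)) :=
    continuous_one.indicator (by simp [hcl.frontier_eq])
  have hsupp : HasCompactSupport ((sheet S v).indicator (1 : S.X × ℕ → ℝ)) :=
    HasCompactSupport.intro (isCompact_sheet v) fun p hp => indicator_of_notMem hp _
  have := h.tendsto _ hf hsupp
  simp only [integral_indicator_one (measurableSet_sheet v)] at this
  rw [← h.measure_sheet v]
  refine (ENNReal.tendsto_toReal_iff (fun n => ?_) ?_).1 this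
  · rw [cesaro_sheet _ _ hv]
    exact ne_top_of_le_ne_top H.weighted_baseDensity_ne_top (H.cesaroDensity_mul_le n hv)
  · rw [h.measure_sheet v]
    exact (h.measure_level_lt_top v).ne

theorem tendsto_cesaroDensity {v : ℕ} (hv : v ∈ H.α) :
    Tendsto (fun n => H.cesaroDensity n v) atTop (𝓝 (H.density μhat v)) := by
  have h0 := (H.measure_D_pos hv).ne'
  have h1 : ∀ n, H.cesaroDensity n v = H.cesaro n (sheet S v) / S.μ (H.D v) := fun n => by
    rw [cesaro_sheet _ _ hv, ENNReal.mul_div_cancel_right h0 (measure_ne_top _ _)]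
  simp_rw [h1]
  exact ENNReal.Tendsto.div_const (h.tendsto_cesaro_sheet hv) (Or.inr h0)

theorem density_lt_top {v : ℕ} (hv : v ∈ H.α) : H.density μhat v < ⊤ :=
  ENNReal.div_lt_top (h.measure_level_lt_top v).ne (H.measure_D_pos hv).ne'

theorem weighted_density_ne_top : H.weighted (H.density μhat) univ ≠ ⊤ := by
  refine ne_top_of_le_ne_top H.weighted_baseDensity_ne_top ?_
  rw [weighted_univ, ENNReal.tsum_eq_iSup_sum]
  refine iSup_le fun s => ?_
  have : Tendsto (fun n => ∑ v ∈ s, H.cesaroDensity n v * S.μ (H.D v)) atTop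
      (𝓝 (∑ v ∈ s, H.density μhat v * S.μ (H.D v))) := tendsto_finsetSum s fun v _ => ?_
  · exact le_of_tendsto' this fun n => H.sum_cesaroDensity_le n s
  exact ENNReal.Tendsto.mul_const (h.tendsto_cesaroDensity v.2) (Or.inr (measure_ne_top _ _))

/-- Only an inequality survives the limit at first, as a level may have infinitely many
predecessors; finite sums of predecessors are bounded and the supremum is taken afterwards. -/
theorem transfer_density_le {v : ℕ} (hv : v ∈ H.α) :
    H.transfer (H.density μhat) v ≤ H.density μhat v := by
  classical
  rw [transfer, ENNReal.tsum_eq_iSup_sum]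
  refine iSup_le fun s => ?_
  have h1 : Tendsto (fun n => ∑ t ∈ s,
      (if H.Arrow t v then H.cesaroDensity n t / S.s (H.branch t) else 0)) atTop
      (𝓝 (∑ t ∈ s, (if H.Arrow t v then H.density μhat t / S.s (H.branch t) else 0))) := by
    refine tendsto_finsetSum s fun t _ => ?_
    split_ifs
    · exact ENNReal.Tendsto.div_const (h.tendsto_cesaroDensity t.2) (Or.inr (s_ne_zero _))
    · exact tendsto_const_nhds
  -- Every iterate of the base density at `v` is bounded by total mass over `μ (D v)`, so the
  -- boundary term is at most `C / n`.
  set C := H.weighted H.baseDensity univ / S.μ (H.D v) with hC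
  have hCtop : C ≠ ⊤ :=
    (ENNReal.div_lt_top H.weighted_baseDensity_ne_top (H.measure_D_pos hv).ne').ne
  have h2 : Tendsto (fun n : ℕ => H.cesaroDensity n v + (n : ℝ≥0∞)⁻¹ * C) atTop
      (𝓝 (H.density μhat v + 0 * C)) :=
    (h.tendsto_cesaroDensity hv).add
      (ENNReal.Tendsto.mul_const ENNReal.tendsto_inv_nat_nhds_zero (Or.inr hCtop))
  rw [zero_mul, add_zero] at h2
  refine le_of_tendsto_of_tendsto' h1 h2 fun n => ?_
  refine (H.sum_transfer_cesaroDensity_le n v s).trans ?_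
  gcongr
  rw [hC, ENNReal.le_div_iff_mul_le (Or.inl (H.measure_D_pos hv).ne')
    (Or.inl (measure_ne_top _ _)), ← weighted_iterate_univ H _ n]
  exact H.density_mul_le _ hv

/-- A subinvariant finite measure whose image has the same total mass is invariant. -/
theorem map_weighted_density :
    (H.weighted (H.density μhat)).map H.towerMap = H.weighted (H.density μhat) := by
  rw [map_weighted]
  have : IsFiniteMeasure (H.weighted (H.density μhat)) :=
    ⟨lt_top_iff_ne_top.2 h.weighted_density_ne_top⟩
  have : IsFiniteMeasure (H.weighted (H.transfer (H.density μhat))) :=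
    ⟨by rw [weighted_transfer_univ]; exact lt_top_iff_ne_top.2 h.weighted_density_ne_top⟩
  refine Measure.eq_of_le_of_measure_univ_eq ?_ (H.weighted_transfer_univ _)
  refine Measure.le_iff.2 fun E hE => ?_
  rw [weighted_apply _ _ hE, weighted_apply _ _ hE]
  exact ENNReal.tsum_le_tsum fun v => mul_le_mul_left (h.transfer_density_le v.2) _

theorem ae_frequently_level (u : ℕ) : ∀ᵐ p ∂H.weighted (H.density μhat), p ∈ sheet S u →
    ∃ᶠ n in atTop, H.towerMap^[n] p ∈ sheet S u := by
  have : IsFiniteMeasure (H.weighted (H.density μhat)) :=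
    ⟨lt_top_iff_ne_top.2 h.weighted_density_ne_top⟩
  exact ae_frequently_of_map_eq (H.aemeasurable_towerMap_weighted _) h.map_weighted_density
    (measurableSet_sheet u).nullMeasurableSet

theorem ae_exists_return {u : ℕ} (hu : u ∈ H.α) (hpos : 0 < μhat (H.level u)) :
    ∀ᵐ x ∂S.μ, x ∈ H.D u → ∃ n : ℕ, 1 ≤ n ∧ (H.towerMap^[n] (x, u)).2 = u := by
  have h1 := h.ae_frequently_level u
  rw [weighted, Measure.ae_sum_iff] at h1
  have h2 := h1 ⟨u, hu⟩
  -- A positive density on `D u` turns almost everywhere statements for the invariant measure into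
  -- statements for `μ` on that level.
  have h0 : H.density μhat u ≠ 0 := fun h0 => by
    have := H.density_mul (μhat := μhat) hu
    rw [h0, zero_mul] at this
    exact hpos.ne this
  rw [Measure.ae_ennreal_smul_measure_iff h0, (measurableEmbedding_mk u).ae_map_iff,
    ae_restrict_iff'₀ (H.nullMeasurableSet_D hu)] at h2
  filter_upwards [h2] with x hx hxD
  obtain ⟨n, hn, hn'⟩ := (frequently_atTop.1 (hx hxD ⟨trivial, rfl⟩)) 1
  exact ⟨n, hn, hn'.2⟩

end IsLift

end Tower

/-! ### Paths in the Markov graph -/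

namespace Tower

variable {d : ℕ} {S : PiecewiseSystem d} (H : Tower S)

/-- `l` followed by `v` is a path in the Markov graph. -/
def IsPath (v : ℕ) : List ℕ → Prop
  | [] => True
  | t :: l => t ∈ H.α ∧ H.Arrow t (l.headD v) ∧ IsPath v l

/-- The points whose orbit in the tower follows the path `l` and ends in the level `D v`. -/
def branchSet (v : ℕ) : List ℕ → Set S.X
  | [] => H.D v
  | t :: l => {x | x ∈ H.D t ∧ H.nextLevel x t = l.headD v ∧ S.T x ∈ branchSet v l}

/-- The Jacobian along a path. -/
def jac (l : List ℕ) : ℝ≥0 := (l.map fun t => S.s (H.branch t)).prod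

/-- The action on the heights of the natural extension along a path from `l` to `v`. -/
def heightMap (μhat : Measure (S.X × ℕ)) (v : ℕ) : List ℕ → ℝ → ℝ
  | [], y => y
  | t :: l, y => heightMap μhat v l (y / (S.s (H.branch t) : ℝ) + H.offset μhat t (l.headD v))

/-- A first return path from `u` to `u`. -/
def IsLoop (u : ℕ) (l : List ℕ) : Prop := (∃ a, l = u :: a ∧ u ∉ a) ∧ H.IsPath u l

variable {H}

theorem s_pos (j : Fin S.N) : 0 < S.s j := zero_lt_one.trans_le (S.one_le_s j)

theorem jac_cons (t : ℕ) (l : List ℕ) : H.jac (t :: l) = S.s (H.branch t) * H.jac l := by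
  simp [jac]

theorem jac_pos (l : List ℕ) : 0 < H.jac l := by
  induction l with
  | nil => simp [jac]
  | cons t l ih =>
    rw [jac_cons]
    exact mul_pos (s_pos _) ih

theorem IsPath.headD_mem {v : ℕ} (hv : v ∈ H.α) {l : List ℕ} (h : H.IsPath v l) :
    l.headD v ∈ H.α := by
  cases l with
  | nil => exact hv
  | cons t l => exact h.1

theorem headD_concat (l : List ℕ) (t v : ℕ) : (l ++ [t]).headD v = l.headD t := by
  cases l <;> rfl

theorem isPath_concat {v t : ℕ} {l : List ℕ} :
    H.IsPath v (l ++ [t]) ↔ H.IsPath t l ∧ t ∈ H.α ∧ H.Arrow t v := by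
  induction l with
  | nil => simp [IsPath]
  | cons a l ih => simp [IsPath, ih, and_assoc, headD_concat, -List.headD_eq_head?_getD]

theorem branchSet_subset (v : ℕ) (l : List ℕ) : H.branchSet v l ⊆ H.D (l.headD v) := by
  cases l with
  | nil => exact Subset.rfl
  | cons t l => exact fun x hx => hx.1

theorem iterate_mem_of_mem_branchSet {v : ℕ} {l : List ℕ} {x : S.X} (hx : x ∈ H.branchSet v l) :
    S.T^[l.length] x ∈ H.D v := by
  induction l generalizing x with
  | nil => exact hx
  | cons t l ih => exact ih hx.2.2

theorem iterate_mem_D_of_mem_branchSet {v : ℕ} {l : List ℕ} {x : S.X}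
    (hx : x ∈ H.branchSet v l) (k : ℕ) (hk : k < l.length) : S.T^[k] x ∈ H.D l[k] := by
  induction l generalizing x k with
  | nil => simp at hk
  | cons t l ih =>
    cases k with
    | zero => exact hx.1
    | succ k => exact ih hx.2.2 k (by simpa using hk)

/-- Each arrow in the path contributes a full branch, so the Jacobians multiply. -/
theorem measure_branchSet {v : ℕ} (hv : v ∈ H.α) {l : List ℕ} (hl : H.IsPath v l) {E : Set S.X}
    (hE : NullMeasurableSet E S.μ) :
    NullMeasurableSet (H.branchSet v l ∩ S.T^[l.length] ⁻¹' E) S.μ ∧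
      S.μ (H.branchSet v l ∩ S.T^[l.length] ⁻¹' E) = S.μ (H.D v ∩ E) / H.jac l := by
  classical
  induction l with
  | nil => exact ⟨(H.nullMeasurableSet_D hv).inter hE, by simp [branchSet, jac]⟩
  | cons t l ih =>
    obtain ⟨h1, h2, h3⟩ := hl
    obtain ⟨h4, h5⟩ := ih h3
    have he : H.branchSet v (t :: l) ∩ S.T^[(t :: l).length] ⁻¹' E =
        {x | x ∈ H.D t ∧ H.nextLevel x t = l.headD v ∧
          S.T x ∈ H.branchSet v l ∩ S.T^[l.length] ⁻¹' E} := by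
      ext x
      constructor
      · rintro ⟨⟨h6, h7, h8⟩, h9⟩
        exact ⟨h6, h7, h8, h9⟩
      · rintro ⟨h6, h7, h8, h9⟩
        exact ⟨⟨h6, h7, h8⟩, h9⟩
    have key := H.measure_branch h1 (h3.headD_mem hv) h4
    rw [he]
    refine ⟨key.1, ?_⟩
    rw [key.2, if_pos h2, inter_eq_right.2 (inter_subset_left.trans (branchSet_subset v l)), h5,
      jac_cons, ENNReal.coe_mul, div_eq_mul_inv, div_eq_mul_inv, div_eq_mul_inv,
      ENNReal.mul_inv (Or.inl (s_ne_zero _)) (Or.inl ENNReal.coe_ne_top)]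
    ring

/-- The orbit determines each next level, and avoidance of `u` makes both paths stop at the same
first visit. -/
theorem branchSet_unique {u : ℕ} {a b : List ℕ} {x : S.X} (ha : x ∈ H.branchSet u a)
    (hb : x ∈ H.branchSet u b) (hua : u ∉ a) (hub : u ∉ b) (hab : a.headD u = b.headD u) :
    a = b := by
  induction a generalizing b x with
  | nil =>
    cases b with
    | nil => rfl
    | cons t b =>
      have : u = t := hab
      exact absurd (this ▸ List.mem_cons_self) hub
  | cons s a ih =>
    cases b with
    | nil =>
      have : s = u := hab
      exact absurd (this ▸ List.mem_cons_self) hua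
    | cons t b =>
      obtain rfl : s = t := hab
      rw [ih ha.2.2 hb.2.2 (fun h => hua (List.mem_cons_of_mem _ h))
        (fun h => hub (List.mem_cons_of_mem _ h)) (ha.2.1.symm.trans hb.2.1)]

theorem IsLoop.eq_of_mem {u : ℕ} {l l' : List ℕ} (hl : H.IsLoop u l) (hl' : H.IsLoop u l') {x : S.X}
    (hx : x ∈ H.branchSet u l) (hx' : x ∈ H.branchSet u l') : l = l' := by
  obtain ⟨⟨a, rfl, ha⟩, -⟩ := hl
  obtain ⟨⟨b, rfl, hb⟩, -⟩ := hl'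
  rw [branchSet_unique hx.2.2 hx'.2.2 ha hb (hx.2.1.symm.trans hx'.2.1)]

/-- The point lies in its level and moves along an arrow. -/
def IsRegular (H : Tower S) (p : S.X × ℕ) : Prop :=
  p.2 ∈ H.α ∧ p.1 ∈ H.D p.2 ∧ H.Arrow p.2 (H.towerMap p).2

/-- The time `n` need not be the first visit to `u`; the path is cut as soon as `u` appears. -/
theorem exists_branchSet {u n : ℕ} {p : S.X × ℕ} (hp : ∀ k : ℕ, H.IsRegular (H.towerMap^[k] p))
    (hn : (H.towerMap^[n] p).2 = u) :
    ∃ l, u ∉ l ∧ H.IsPath u l ∧ p.1 ∈ H.branchSet u l ∧ l.headD u = p.2 := by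
  induction n generalizing p with
  | zero =>
    obtain rfl : p.2 = u := hn
    exact ⟨[], by simp, trivial, (hp 0).2.1, rfl⟩
  | succ n ih =>
    by_cases h : p.2 = u
    · subst h
      exact ⟨[], by simp, trivial, (hp 0).2.1, rfl⟩
    · obtain ⟨l, h1, h2, h3, h4⟩ := ih (p := H.towerMap p) (fun k => hp (k + 1)) hn
      refine ⟨p.2 :: l, ?_, ⟨(hp 0).1, ?_, h2⟩, ⟨(hp 0).2.1, h4.symm, h3⟩, rfl⟩
      · simp [h1, Ne.symm h]
      · rw [h4]
        exact (hp 0).2.2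

theorem exists_isLoop {u n : ℕ} {x : S.X} (hp : ∀ k : ℕ, H.IsRegular (H.towerMap^[k] (x, u)))
    (hn : 1 ≤ n) (h : (H.towerMap^[n] (x, u)).2 = u) :
    ∃ l, H.IsLoop u l ∧ x ∈ H.branchSet u l := by
  obtain ⟨n, rfl⟩ := Nat.exists_eq_add_of_le' hn
  obtain ⟨l, h1, h2, h3, h4⟩ := exists_branchSet (p := H.towerMap (x, u)) (fun k => hp (k + 1)) h
  refine ⟨u :: l, ⟨⟨l, rfl, h1⟩, (hp 0).1, ?_, h2⟩, (hp 0).2.1, h4.symm, h3⟩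
  rw [h4]
  exact (hp 0).2.2

theorem ae_isRegular {u : ℕ} (hu : u ∈ H.α) :
    ∀ᵐ x ∂S.μ, x ∈ H.D u → ∀ k : ℕ, H.IsRegular (H.towerMap^[k] (x, u)) := by
  refine H.ae_muBar_iff.1 (H.ae_muBar_iterate (H.ae_muBar_iff.2 fun v hv => ?_)) u hu
  filter_upwards [H.ae_nextLevel hv] with x hx hxD
  exact ⟨hv, hxD, (hx hxD).2.1⟩

/-! ### Heights -/

section Height

variable {μhat : Measure (S.X × ℕ)}

theorem rho_nonneg (v : ℕ) : 0 ≤ H.rho μhat v := by rw [rho_eq]; positivity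

theorem heightMap_concat (v t : ℕ) (l : List ℕ) (y : ℝ) :
    H.heightMap μhat v (l ++ [t]) y =
      H.heightMap μhat t l y / (S.s (H.branch t) : ℝ) + H.offset μhat t v := by
  induction l generalizing y with
  | nil => rfl
  | cons a l ih => rw [List.cons_append, heightMap, ih, headD_concat, heightMap]

theorem heightMap_eq (v : ℕ) (l : List ℕ) (y : ℝ) :
    H.heightMap μhat v l y = y / (H.jac l : ℝ) + H.heightMap μhat v l 0 := by
  induction l generalizing y with
  | nil => simp [heightMap, jac]
  | cons t l ih =>
    rw [heightMap, ih, heightMap, ih (0 / _ + _), jac_cons, NNReal.coe_mul]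
    have h1 : (H.jac l : ℝ) ≠ 0 := by exact_mod_cast (jac_pos l).ne'
    have h2 : (S.s (H.branch t) : ℝ) ≠ 0 := by exact_mod_cast (s_pos _).ne'
    field_simp
    ring

theorem natExt_iterate {v : ℕ} {l : List ℕ} {x : S.X} (hx : x ∈ H.branchSet v l) (y : ℝ) :
    (H.natExt μhat)^[l.length] ((x, l.headD v), y) =
      ((S.T^[l.length] x, v), H.heightMap μhat v l y) := by
  induction l generalizing x y with
  | nil => rfl
  | cons t l ih =>
    have h1 : H.natExt μhat ((x, t), y) = ((S.T x, l.headD v),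
        y / (S.s (H.branch t) : ℝ) + H.offset μhat t (l.headD v)) := by
      rw [← hx.2.1]
      rfl
    have h2 : (t :: l).headD v = t := rfl
    rw [h2, List.length_cons, Function.iterate_succ_apply, h1, ih hx.2.2]
    rfl

theorem natExt_iterate_level {v : ℕ} {l : List ℕ} {x : S.X} (hx : x ∈ H.branchSet v l) (y : ℝ)
    (k : ℕ) (hk : k < l.length) : ((H.natExt μhat)^[k] ((x, l.headD v), y)).1.2 = l[k] := by
  induction l generalizing x y k with
  | nil => simp at hk
  | cons t l ih =>
    cases k with
    | zero => rfl
    | succ k =>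
      have h1 : H.natExt μhat ((x, t), y) = ((S.T x, l.headD v),
          y / (S.s (H.branch t) : ℝ) + H.offset μhat t (l.headD v)) := by
        rw [← hx.2.1]
        rfl
      have h2 : (t :: l).headD v = t := rfl
      rw [h2, Function.iterate_succ_apply, h1, ih hx.2.2 _ k (by simpa using hk)]
      rfl

-- The strips entering the rug of `D v` have total height at most `ρ (D v)`: this is subinvariance
-- of the density, and it is what lets the stacking fit.
open Classical in
theorem IsLift.sum_rho_le (h : H.IsLift μhat) {v : ℕ} (hv : v ∈ H.α) (n : ℕ) :
    ∑ t ∈ (Finset.range n).filter (fun t => t ∈ H.α ∧ H.Arrow t v),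
      H.rho μhat t / (S.s (H.branch t) : ℝ) ≤ H.rho μhat v := by
  set F := (Finset.range n).filter fun t => t ∈ H.α ∧ H.Arrow t v with hF
  have hmem : ∀ t ∈ F, t ∈ H.α ∧ H.Arrow t v := fun t ht => (Finset.mem_filter.1 ht).2
  have h1 : ∑ t ∈ F, H.density μhat t / S.s (H.branch t) ≤ H.density μhat v := by
    refine le_trans ?_ (h.transfer_density_le hv)
    rw [← Finset.sum_subtype_of_mem _ fun t ht => (hmem t ht).1]
    refine le_trans (le_of_eq (Finset.sum_congr rfl fun t ht => ?_))
      (ENNReal.sum_le_tsum (F.subtype (· ∈ H.α)))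
    rw [if_pos (hmem t (Finset.mem_subtype.1 ht)).2]
  have h2 : ∀ t ∈ F, H.rho μhat t / (S.s (H.branch t) : ℝ) =
      (H.density μhat t / S.s (H.branch t)).toReal := fun t _ => by
    rw [rho_eq, ENNReal.toReal_div, ENNReal.coe_toReal]
  rw [Finset.sum_congr rfl h2, ← ENNReal.toReal_sum, rho_eq]
  · exact ENNReal.toReal_mono (h.density_lt_top hv).ne h1
  · exact fun t ht => (ENNReal.div_lt_top (h.density_lt_top (hmem t ht).1).ne (s_ne_zero _)).ne

open Classical in
theorem offset_succ {t v : ℕ} (ht : t ∈ H.α) (htv : H.Arrow t v) :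
    H.offset μhat (t + 1) v = H.offset μhat t v + H.rho μhat t / (S.s (H.branch t) : ℝ) := by
  rw [offset, Finset.range_add_one, Finset.filter_insert, if_pos ⟨ht, htv⟩,
    Finset.sum_insert (by simp), add_comm]
  rfl

theorem offset_mono {t t' : ℕ} (h : t ≤ t') (v : ℕ) : H.offset μhat t v ≤ H.offset μhat t' v := by
  classical
  unfold offset
  refine Finset.sum_le_sum_of_subset_of_nonneg ?_ fun i _ _ => ?_
  · exact Finset.filter_subset_filter _ (Finset.range_mono h)
  · exact div_nonneg (rho_nonneg i) NNReal.zero_le_coe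

theorem offset_nonneg (t v : ℕ) : 0 ≤ H.offset μhat t v := by
  have := offset_mono (H := H) (μhat := μhat) (Nat.zero_le t) v
  simpa [offset] using this

theorem div_add_offset_lt {t v : ℕ} (ht : t ∈ H.α) (htv : H.Arrow t v) {y : ℝ}
    (hy : y < H.rho μhat t) :
    y / (S.s (H.branch t) : ℝ) + H.offset μhat t v < H.offset μhat (t + 1) v := by
  have : (0 : ℝ) < S.s (H.branch t) := by exact_mod_cast s_pos _
  rw [offset_succ ht htv, add_comm]
  gcongr

theorem IsLift.heightMap_mem (h : H.IsLift μhat) {v : ℕ} (hv : v ∈ H.α) {l : List ℕ}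
    (hl : H.IsPath v l) {y : ℝ} (hy : y ∈ Ioo 0 (H.rho μhat (l.headD v))) :
    H.heightMap μhat v l y ∈ Ioo 0 (H.rho μhat v) := by
  induction l generalizing y with
  | nil => exact hy
  | cons t l ih =>
    obtain ⟨h1, h2, h3⟩ := hl
    have hs : (0 : ℝ) < S.s (H.branch t) := by exact_mod_cast s_pos _
    refine ih h3 ⟨?_, ?_⟩
    · exact add_pos_of_pos_of_nonneg (div_pos hy.1 hs) (offset_nonneg _ _)
    · exact (div_add_offset_lt h1 h2 hy.2).trans_le (h.sum_rho_le (h3.headD_mem hv) _)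

theorem eq_of_concat {u t : ℕ} {m a : List ℕ} (h : m ++ [t] = u :: a) (hu : u ∉ a) :
    (m = [] ∧ t = u) ∨ ((∃ b, m = u :: b ∧ u ∉ b) ∧ t ≠ u) := by
  cases m with
  | nil =>
    simp only [List.nil_append, List.cons.injEq] at h
    exact Or.inl ⟨rfl, h.1⟩
  | cons c m =>
    simp only [List.cons_append, List.cons.injEq] at h
    obtain ⟨rfl, rfl⟩ := h
    simp only [List.mem_append, List.mem_singleton, not_or] at hu
    exact Or.inr ⟨⟨m, rfl, hu.1⟩, Ne.symm hu.2⟩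

/-- The strips in a rug are stacked disjointly, so the final height reveals the last level before
`v`. Undoing that step and repeating recovers the path from its end. Open intervals avoid ambiguity
at common endpoints. -/
theorem IsLift.heightMap_injective (h : H.IsLift μhat) {u v : ℕ} {l l' : List ℕ}
    (hl : ∃ a, l = u :: a ∧ u ∉ a) (hl' : ∃ a, l' = u :: a ∧ u ∉ a)
    (hp : H.IsPath v l) (hp' : H.IsPath v l') {y y' : ℝ} (hy : y ∈ Ioo 0 (H.rho μhat u))
    (hy' : y' ∈ Ioo 0 (H.rho μhat u))
    (he : H.heightMap μhat v l y = H.heightMap μhat v l' y') : l = l' := by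
  induction l using List.reverseRecOn generalizing l' v with
  | nil => simp at hl
  | append_singleton m t ih =>
    rcases List.eq_nil_or_concat' l' with rfl | ⟨m', t', rfl⟩
    · simp at hl'
    rw [isPath_concat] at hp hp'
    have hne : ∀ {m : List ℕ} {t : ℕ}, (∃ a, m ++ [t] = u :: a ∧ u ∉ a) → m.headD t = u := by
      rintro m t ⟨a, ha, hu⟩
      rcases eq_of_concat ha hu with ⟨rfl, rfl⟩ | ⟨⟨b, rfl, -⟩, -⟩ <;> rfl
    have hm := h.heightMap_mem hp.2.1 hp.1 (y := y) (by rwa [hne hl])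
    have hm' := h.heightMap_mem hp'.2.1 hp'.1 (y := y') (by rwa [hne hl'])
    rw [heightMap_concat, heightMap_concat] at he
    have hs : ∀ t, (0 : ℝ) < S.s (H.branch t) := fun t => by exact_mod_cast s_pos _
    have htt : t = t' := by
      -- If `t < t'`, the height coming from `t` is below `offset (t + 1) v`, hence below the base
      -- of the strip of `t'`.
      rcases lt_trichotomy t t' with hlt | heq | hlt
      · have h1 := div_add_offset_lt hp.2.1 hp.2.2 hm.2
        have h2 := offset_mono (H := H) (μhat := μhat) (Nat.succ_le_of_lt hlt) v
        have h3 := div_pos hm'.1 (hs t')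
        rw [Nat.succ_eq_add_one] at h2
        linarith
      · exact heq
      · have h1 := div_add_offset_lt hp'.2.1 hp'.2.2 hm'.2
        have h2 := offset_mono (H := H) (μhat := μhat) (Nat.succ_le_of_lt hlt) v
        have h3 := div_pos hm.1 (hs t)
        rw [Nat.succ_eq_add_one] at h2
        linarith
    subst htt
    rw [add_left_inj, div_left_inj' (hs t).ne'] at he
    obtain ⟨a, ha, hu⟩ := hl
    obtain ⟨a', ha', hu'⟩ := hl'
    -- Since `u` occurs only at the start, the remaining prefix is empty exactly when the last level
    -- is `u`; both paths therefore end together.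
    rcases eq_of_concat ha hu with ⟨rfl, htu⟩ | ⟨hm1, htu⟩ <;>
      rcases eq_of_concat ha' hu' with ⟨rfl, htu'⟩ | ⟨hm1', htu'⟩
    · rfl
    · exact absurd htu htu'
    · exact absurd htu' htu
    · rw [ih hm1 hm1' hp.1 hp'.1 he]

end Height

end Tower

/-! ### The itineraries of the two components -/

theorem FullBranch.of_ae {X A : Type*} [MeasurableSpace X] [MeasurableSpace A] [Countable A]
    {m : Measure X} {w : X → A} {G : X → X} {p : Measure A} (L : Set A)
    (h1 : ∀ l ∈ L, ∀ E, NullMeasurableSet E m → NullMeasurableSet (w ⁻¹' {l} ∩ G ⁻¹' E) m ∧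
      m (w ⁻¹' {l} ∩ G ⁻¹' E) = p {l} * m E)
    (h2 : ∀ᵐ x ∂m, w x ∈ L) (h3 : ∀ l ∉ L, p {l} = 0) : FullBranch m w G p := by
  have hnull : ∀ l ∉ L, m (w ⁻¹' {l}) = 0 := fun l hl => by
    refine measure_eq_zero_iff_ae_notMem.2 ?_
    filter_upwards [h2] with x hx hxl
    exact hl (hxl ▸ hx)
  refine ⟨fun E hE => ?_, fun a => ?_, fun a E hE => ?_⟩
  · have : G ⁻¹' E = ⋃ a, (w ⁻¹' {a} ∩ G ⁻¹' E) := by ext; simp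
    rw [this]
    refine .iUnion fun a => ?_
    by_cases ha : a ∈ L
    · exact (h1 a ha E hE).1
    · exact .of_null (measure_inter_null_of_null_left _ (hnull a ha))
  · by_cases ha : a ∈ L
    · simpa using (h1 a ha univ nullMeasurableSet_univ).1
    · exact .of_null (hnull a ha)
  · by_cases ha : a ∈ L
    · exact (h1 a ha E hE).2
    · rw [h3 a ha, zero_mul]
      exact measure_inter_null_of_null_left _ (hnull a ha)

/-! ### Normalised restrictions of measures -/

section Normalized

variable {X : Type*} [MeasurableSpace X] {μ : Measure X} {D E : Set X}

/-- The normalised restriction of a measure. -/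
def normalized (μ : Measure X) (D : Set X) : Measure X := (μ D)⁻¹ • μ.restrict D

theorem normalized_apply (hD : NullMeasurableSet D μ) (E : Set X) :
    normalized μ D E = (μ D)⁻¹ * μ (D ∩ E) := by
  rw [normalized, Measure.smul_apply, smul_eq_mul, Measure.restrict_apply₀' hD, inter_comm]

theorem isProbabilityMeasure_normalized (hD : NullMeasurableSet D μ) (h0 : μ D ≠ 0) (h1 : μ D ≠ ⊤) :
    IsProbabilityMeasure (normalized μ D) :=
  ⟨by rw [normalized_apply hD, inter_univ, ENNReal.inv_mul_cancel h0 h1]⟩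

theorem normalized_absolutelyContinuous : normalized μ D ≪ μ :=
  Measure.smul_absolutelyContinuous.trans Measure.restrict_le_self.absolutelyContinuous

theorem nullMeasurableSet_inter_of_normalized (hD : NullMeasurableSet D μ) (h1 : μ D ≠ ⊤)
    (hE : NullMeasurableSet E (normalized μ D)) : NullMeasurableSet (D ∩ E) μ := by
  have : NullMeasurableSet E (μ.restrict D) :=
    hE.mono_ac (Measure.absolutelyContinuous_smul (ENNReal.inv_ne_zero.2 h1))
  rw [inter_comm]
  exact (nullMeasurableSet_restrict hD).1 this

theorem ae_normalized_iff (hD : NullMeasurableSet D μ) (h1 : μ D ≠ ⊤) {P : X → Prop} :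
    (∀ᵐ x ∂normalized μ D, P x) ↔ ∀ᵐ x ∂μ, x ∈ D → P x := by
  rw [normalized, Measure.ae_ennreal_smul_measure_iff (ENNReal.inv_ne_zero.2 h1),
    ae_restrict_iff'₀ hD]

end Normalized

instance : MeasurableSpace (List ℕ) := ⊤

instance : DiscreteMeasurableSpace (List ℕ) := ⟨fun _ => trivial⟩

namespace Tower

variable {d : ℕ} {S : PiecewiseSystem d} (H : Tower S)

open Classical in
/-- The first return path that the point `x` of the level `D u` follows. -/
def loopOf (u : ℕ) (x : S.X) : List ℕ :=
  if h : ∃ l, H.IsLoop u l ∧ x ∈ H.branchSet u l then h.choose else []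

/-- The first return map of the tower to the level `D u`. -/
def levelReturn (u : ℕ) (x : S.X) : S.X := S.T^[(H.loopOf u x).length] x

/-- The law of the first return path. -/
def loopLaw (u : ℕ) : Measure (List ℕ) := (normalized S.μ (H.D u)).map (H.loopOf u)

variable {H}

/-- The default value `[]` of `loopOf` and `backLoop` is not a loop, so a loop as value certifies
that the point really follows it. -/
theorem not_isLoop_nil (u : ℕ) : ¬ H.IsLoop u [] := fun ⟨⟨_, h, _⟩, _⟩ => by simp at h

theorem IsLoop.headD_eq {u : ℕ} {l : List ℕ} (hl : H.IsLoop u l) (v : ℕ) : l.headD v = u := by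
  obtain ⟨⟨a, rfl, -⟩, -⟩ := hl
  rfl

theorem loopOf_eq_iff {u : ℕ} {l : List ℕ} (hl : H.IsLoop u l) {x : S.X} :
    H.loopOf u x = l ↔ x ∈ H.branchSet u l := by
  constructor
  · intro h
    rw [loopOf] at h
    split_ifs at h with hex
    · exact h ▸ hex.choose_spec.2
    · exact absurd (h ▸ hl) (not_isLoop_nil u)
  · intro h
    have hex : ∃ l, H.IsLoop u l ∧ x ∈ H.branchSet u l := ⟨l, hl, h⟩
    rw [loopOf, dif_pos hex]
    exact hex.choose_spec.1.eq_of_mem hl hex.choose_spec.2 h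

theorem normalized_branch {u : ℕ} (hu : u ∈ H.α) {l : List ℕ} (hl : H.IsLoop u l) {E : Set S.X}
    (hE : NullMeasurableSet E (normalized S.μ (H.D u))) :
    NullMeasurableSet (H.loopOf u ⁻¹' {l} ∩ H.levelReturn u ⁻¹' E) (normalized S.μ (H.D u)) ∧
      normalized S.μ (H.D u) (H.loopOf u ⁻¹' {l} ∩ H.levelReturn u ⁻¹' E) =
        (H.jac l : ℝ≥0∞)⁻¹ * normalized S.μ (H.D u) E := by
  have hD := H.nullMeasurableSet_D hu
  have he : H.loopOf u ⁻¹' {l} ∩ H.levelReturn u ⁻¹' E =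
      H.branchSet u l ∩ S.T^[l.length] ⁻¹' (H.D u ∩ E) := by
    ext x
    constructor
    · rintro ⟨h1, h2⟩
      have h3 := (loopOf_eq_iff hl).1 h1
      have h1' : H.loopOf u x = l := h1
      rw [mem_preimage, levelReturn, h1'] at h2
      exact ⟨h3, iterate_mem_of_mem_branchSet h3, h2⟩
    · rintro ⟨h1, -, h2⟩
      have h3 := (loopOf_eq_iff hl).2 h1
      refine ⟨h3, ?_⟩
      rw [mem_preimage, levelReturn, h3]
      exact h2
  obtain ⟨h1, h2⟩ := measure_branchSet hu hl.2
    (nullMeasurableSet_inter_of_normalized hD (measure_ne_top _ _) hE)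
  have hsub : H.branchSet u l ⊆ H.D u := by
    have := H.branchSet_subset u l
    rwa [hl.headD_eq] at this
  rw [he]
  refine ⟨h1.mono_ac normalized_absolutelyContinuous, ?_⟩
  rw [normalized_apply hD, normalized_apply hD, inter_eq_right.2 (inter_subset_left.trans hsub), h2,
    ← inter_assoc, inter_self, div_eq_mul_inv]
  ring

section Lift

variable {μhat : Measure (S.X × ℕ)} (h : H.IsLift μhat) {u : ℕ} (hu : u ∈ H.α)
include hu

theorem isProbabilityMeasure_level : IsProbabilityMeasure (normalized S.μ (H.D u)) :=
  isProbabilityMeasure_normalized (H.nullMeasurableSet_D hu) (H.measure_D_pos hu).ne'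
    (measure_ne_top _ _)

variable (hpos : 0 < μhat (H.level u))
include h hpos

theorem ae_isLoop_loopOf : ∀ᵐ x ∂normalized S.μ (H.D u), H.IsLoop u (H.loopOf u x) := by
  rw [ae_normalized_iff (H.nullMeasurableSet_D hu) (measure_ne_top _ _)]
  filter_upwards [ae_isRegular hu, h.ae_exists_return hu hpos] with x hx hx' hxD
  obtain ⟨n, hn, hn'⟩ := hx' hxD
  obtain ⟨l, hl, hxl⟩ := exists_isLoop (hx hxD) hn hn'
  rwa [(loopOf_eq_iff hl).2 hxl]

theorem aemeasurable_loopOf : AEMeasurable (H.loopOf u) (normalized S.μ (H.D u)) := by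
  refine NullMeasurable.aemeasurable fun A _ => ?_
  rw [← biUnion_of_singleton A, preimage_iUnion₂]
  refine .biUnion (to_countable A) fun l _ => ?_
  by_cases hl : H.IsLoop u l
  · simpa using (normalized_branch hu hl nullMeasurableSet_univ).1
  · refine .of_null (measure_eq_zero_iff_ae_notMem.2 ?_)
    filter_upwards [ae_isLoop_loopOf h hu hpos] with x hx hxl
    exact hl (hxl ▸ hx)

theorem isProbabilityMeasure_loopLaw : IsProbabilityMeasure (H.loopLaw u) := by
  have := isProbabilityMeasure_level (H := H) hu
  exact Measure.isProbabilityMeasure_map (aemeasurable_loopOf h hu hpos)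

theorem loopLaw_singleton {l : List ℕ} (hl : H.IsLoop u l) :
    H.loopLaw u {l} = (H.jac l : ℝ≥0∞)⁻¹ := by
  have := isProbabilityMeasure_level (H := H) hu
  rw [loopLaw, Measure.map_apply_of_aemeasurable (aemeasurable_loopOf h hu hpos) .of_discrete]
  simpa using (normalized_branch hu hl nullMeasurableSet_univ).2

theorem loopLaw_compl : H.loopLaw u {l | H.IsLoop u l}ᶜ = 0 := by
  rw [loopLaw, Measure.map_apply_of_aemeasurable (aemeasurable_loopOf h hu hpos) .of_discrete]
  exact ae_isLoop_loopOf h hu hpos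

theorem loopLaw_singleton_eq_zero {l : List ℕ} (hl : ¬ H.IsLoop u l) : H.loopLaw u {l} = 0 :=
  measure_mono_null (singleton_subset_iff.2 hl) (loopLaw_compl h hu hpos)

theorem fullBranch_level :
    FullBranch (normalized S.μ (H.D u)) (H.loopOf u) (H.levelReturn u) (H.loopLaw u) := by
  refine .of_ae {l | H.IsLoop u l} (fun l hl E hE => ?_) (ae_isLoop_loopOf h hu hpos)
    fun l hl => loopLaw_singleton_eq_zero h hu hpos hl
  rw [loopLaw_singleton h hu hpos hl]
  exact normalized_branch hu hl hE

end Lift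

/-! ### The itineraries of the heights -/

variable (H) (μhat : Measure (S.X × ℕ))

/-- The heights that are reached along the first return path `l`. -/
def strip (u : ℕ) (l : List ℕ) : Set ℝ := H.heightMap μhat u l '' Ioo 0 (H.rho μhat u)

open Classical in
/-- The first return path along which the height `y` is reached. -/
def backLoop (u : ℕ) (y : ℝ) : List ℕ :=
  if h : ∃ l, H.IsLoop u l ∧ y ∈ H.strip μhat u l then h.choose else []

/-- The height from which `y` is reached along a first return path. -/
def backMap (u : ℕ) (y : ℝ) : ℝ :=
  (y - H.heightMap μhat u (H.backLoop μhat u y) 0) * (H.jac (H.backLoop μhat u y) : ℝ)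

variable {H μhat}

theorem mem_strip_iff {u : ℕ} {l : List ℕ} {y : ℝ} : y ∈ H.strip μhat u l ↔
    (y - H.heightMap μhat u l 0) * (H.jac l : ℝ) ∈ Ioo 0 (H.rho μhat u) := by
  have hJ : (H.jac l : ℝ) ≠ 0 := by exact_mod_cast (jac_pos l).ne'
  constructor
  · rintro ⟨z, hz, rfl⟩
    rw [heightMap_eq, add_sub_cancel_right, div_mul_cancel₀ _ hJ]
    exact hz
  · intro hy
    refine ⟨_, hy, ?_⟩
    rw [heightMap_eq, mul_div_cancel_right₀ _ hJ, sub_add_cancel]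

theorem volume_preimage_affine {o J : ℝ} (hJ : 0 < J) (E : Set ℝ) :
    volume ((fun y => (y - o) * J) ⁻¹' E) = ENNReal.ofReal J⁻¹ * volume E := by
  have : (fun y => (y - o) * J) ⁻¹' E = (fun y => y + -o) ⁻¹' ((fun y => y * J) ⁻¹' E) := by
    ext y
    simp [sub_eq_add_neg]
  rw [this, measure_preimage_add_right, Real.volume_preimage_mul_right hJ.ne',
    abs_of_pos (inv_pos.2 hJ)]

theorem backLoop_eq_iff {μhat : Measure (S.X × ℕ)} (h : H.IsLift μhat) {u : ℕ} {l : List ℕ} (hl : H.IsLoop u l) {y : ℝ} :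
    H.backLoop μhat u y = l ↔ y ∈ H.strip μhat u l := by
  constructor
  · intro h
    rw [backLoop] at h
    split_ifs at h with hex
    · exact h ▸ hex.choose_spec.2
    · exact absurd (h ▸ hl) (not_isLoop_nil u)
  · intro hy
    have hex : ∃ l, H.IsLoop u l ∧ y ∈ H.strip μhat u l := ⟨l, hl, hy⟩
    rw [backLoop, dif_pos hex]
    obtain ⟨h1, y', hy', h2⟩ := hex.choose_spec
    obtain ⟨z, hz, rfl⟩ := hy
    exact h.heightMap_injective h1.1 hl.1 h1.2 hl.2 hy' hz h2

section Lift

variable (h : H.IsLift μhat) {u : ℕ} (hu : u ∈ H.α)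
include h hu

theorem strip_subset {l : List ℕ} (hl : H.IsLoop u l) :
    H.strip μhat u l ⊆ Ioo 0 (H.rho μhat u) := by
  rintro _ ⟨y, hy, rfl⟩
  exact h.heightMap_mem hu hl.2 (by rwa [hl.headD_eq])

theorem rho_pos (hpos : 0 < μhat (H.level u)) : 0 < H.rho μhat u :=
  div_pos (ENNReal.toReal_pos hpos.ne' (h.measure_level_lt_top u).ne)
    (ENNReal.toReal_pos (H.measure_D_pos hu).ne' (measure_ne_top _ _))

/-- On the strip of `l` the backward map is affine of slope `jac l` onto the open interval of
heights; the endpoints are null. -/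
theorem normalized_strip {l : List ℕ} (hl : H.IsLoop u l) {E : Set ℝ}
    (hE : NullMeasurableSet E (normalized volume (Icc 0 (H.rho μhat u)))) :
    NullMeasurableSet (H.backLoop μhat u ⁻¹' {l} ∩ H.backMap μhat u ⁻¹' E)
        (normalized volume (Icc 0 (H.rho μhat u))) ∧
      normalized volume (Icc 0 (H.rho μhat u))
        (H.backLoop μhat u ⁻¹' {l} ∩ H.backMap μhat u ⁻¹' E) =
        (H.jac l : ℝ≥0∞)⁻¹ * normalized volume (Icc 0 (H.rho μhat u)) E := by
  have hD : NullMeasurableSet (Icc 0 (H.rho μhat u)) volume := measurableSet_Icc.nullMeasurableSet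
  have hJ : (0 : ℝ) < H.jac l := by exact_mod_cast jac_pos l
  set f : ℝ → ℝ := fun y => (y - H.heightMap μhat u l 0) * (H.jac l : ℝ) with hf
  have he : H.backLoop μhat u ⁻¹' {l} ∩ H.backMap μhat u ⁻¹' E =
      f ⁻¹' (Ioo 0 (H.rho μhat u) ∩ E) := by
    ext y
    constructor
    · rintro ⟨h1, h2⟩
      have h3 := (backLoop_eq_iff h hl).1 h1
      have h1' : H.backLoop μhat u y = l := h1
      rw [mem_preimage, backMap, h1'] at h2
      exact ⟨mem_strip_iff.1 h3, h2⟩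
    · rintro ⟨h1, h2⟩
      have h3 := (backLoop_eq_iff h hl).2 (mem_strip_iff.2 h1)
      refine ⟨h3, ?_⟩
      rw [mem_preimage, backMap, h3]
      exact h2
  have hfq : Measure.QuasiMeasurePreserving f volume volume := by
    refine ⟨by fun_prop, Measure.AbsolutelyContinuous.mk fun s hs hs0 => ?_⟩
    rw [Measure.map_apply (by fun_prop) hs, volume_preimage_affine hJ, hs0, mul_zero]
  have hIE : Ioo 0 (H.rho μhat u) ∩ E = Ioo 0 (H.rho μhat u) ∩ (Icc 0 (H.rho μhat u) ∩ E) := by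
    rw [← inter_assoc, inter_eq_left.2 Ioo_subset_Icc_self]
  have hm : NullMeasurableSet (Ioo 0 (H.rho μhat u) ∩ E) volume := by
    rw [hIE]
    exact measurableSet_Ioo.nullMeasurableSet.inter
      (nullMeasurableSet_inter_of_normalized hD measure_Icc_lt_top.ne hE)
  have hsub : f ⁻¹' (Ioo 0 (H.rho μhat u) ∩ E) ⊆ Icc 0 (H.rho μhat u) := fun y hy =>
    Ioo_subset_Icc_self (strip_subset h hu hl (mem_strip_iff.2 hy.1))
  have hv : volume (Ioo 0 (H.rho μhat u) ∩ E) = volume (Icc 0 (H.rho μhat u) ∩ E) :=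
    measure_congr (Ioo_ae_eq_Icc.inter (ae_eq_refl _))
  rw [he]
  refine ⟨(hm.preimage hfq).mono_ac normalized_absolutelyContinuous, ?_⟩
  rw [normalized_apply hD, normalized_apply hD, inter_eq_right.2 hsub, volume_preimage_affine hJ, hv,
    ENNReal.ofReal_inv_of_pos hJ, ENNReal.ofReal_coe_nnreal]
  ring

variable (hpos : 0 < μhat (H.level u))
include hpos

theorem isProbabilityMeasure_height :
    IsProbabilityMeasure (normalized volume (Icc 0 (H.rho μhat u))) := by
  refine isProbabilityMeasure_normalized measurableSet_Icc.nullMeasurableSet ?_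
    measure_Icc_lt_top.ne
  simpa using rho_pos h hu hpos

/-- The strips of different loops are disjoint with normalised lengths `1 / jac l`, which are the
probabilities of the loops. These sum to one by recurrence on the level, so nothing of positive
length is left uncovered. -/
theorem ae_isLoop_backLoop : ∀ᵐ y ∂normalized volume (Icc 0 (H.rho μhat u)),
    H.IsLoop u (H.backLoop μhat u y) := by
  have := isProbabilityMeasure_height h hu hpos
  have := isProbabilityMeasure_level (H := H) hu
  have := isProbabilityMeasure_loopLaw h hu hpos
  set L : Set (List ℕ) := {l | H.IsLoop u l} with hL
  have hm : ∀ l ∈ L, NullMeasurableSet (H.backLoop μhat u ⁻¹' {l})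
      (normalized volume (Icc 0 (H.rho μhat u))) ∧
      normalized volume (Icc 0 (H.rho μhat u)) (H.backLoop μhat u ⁻¹' {l}) = H.loopLaw u {l} :=
    fun l hl => by
      have := normalized_strip h hu hl nullMeasurableSet_univ
      rw [loopLaw_singleton h hu hpos hl]
      simpa using this
  have he : {y | H.IsLoop u (H.backLoop μhat u y)} = ⋃ l ∈ L, H.backLoop μhat u ⁻¹' {l} := by
    ext y; simp [hL]
  have hnm : NullMeasurableSet {y | H.IsLoop u (H.backLoop μhat u y)}
      (normalized volume (Icc 0 (H.rho μhat u))) := by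
    rw [he]
    exact .biUnion (to_countable L) fun l hl => (hm l hl).1
  have h1 : normalized volume (Icc 0 (H.rho μhat u)) {y | H.IsLoop u (H.backLoop μhat u y)} = 1 := by
    rw [he, measure_biUnion₀ (to_countable L) _ fun l hl => (hm l hl).1]
    · have h2 : ∑' l : L, H.loopLaw u {(l : List ℕ)} = H.loopLaw u L := by
        rw [← measure_biUnion (to_countable L) _ fun _ _ => .of_discrete]
        · simp
        · intro a _ b _ hab
          simpa using hab
      rw [tsum_congr fun l : L => (hm l l.2).2, h2]
      exact (prob_compl_eq_zero_iff .of_discrete).1 (loopLaw_compl h hu hpos)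
    · intro l _ l' _ hne
      refine Disjoint.aedisjoint (disjoint_left.2 fun y hy hy' => hne ?_)
      exact (show H.backLoop μhat u y = l from hy).symm.trans hy'
  exact (prob_compl_eq_zero_iff₀ hnm).2 h1

theorem fullBranch_height : FullBranch (normalized volume (Icc 0 (H.rho μhat u)))
    (H.backLoop μhat u) (H.backMap μhat u) (H.loopLaw u) := by
  refine .of_ae {l | H.IsLoop u l} (fun l hl E hE => ?_) (ae_isLoop_backLoop h hu hpos)
    fun l hl => loopLaw_singleton_eq_zero h hu hpos hl
  rw [loopLaw_singleton h hu hpos hl]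
  exact normalized_strip h hu hl hE

end Lift

end Tower

/-! ### Points are determined by their itineraries -/

/-- A countable family separating points is replaced, off a null set, by sets generated by
cylinders; such sets cannot distinguish points with equal itineraries. -/
theorem PiecewiseSystem.exists_separated {d : ℕ} (S : PiecewiseSystem d) :
    ∃ Q : Set S.X, (∀ᵐ x ∂S.μ, x ∈ Q) ∧ ∀ x ∈ Q, ∀ x' ∈ Q,
      (∀ (k : ℕ) (j : Fin S.N), S.T^[k] x ∈ S.Z j ↔ S.T^[k] x' ∈ S.Z j) → x = x' := by
  obtain ⟨B, hB, hsep⟩ := exists_seq_separating S.X (p := MeasurableSet) MeasurableSet.empty univ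
  choose B' hB' hae using fun n => S.generating (B n) (hB n).nullMeasurableSet
  refine ⟨{x | ∀ n, x ∈ B n ↔ x ∈ B' n}, ae_all_iff.2 fun n => eventuallyEq_set.1 (hae n), ?_⟩
  intro x hx x' hx' hit
  refine hsep x trivial x' trivial fun n => (hx n).trans (Iff.trans ?_ (hx' n).symm)
  have key : ∀ A : Set S.X, MeasurableSet[MeasurableSpace.generateFrom
      {C : Set S.X | ∃ (n : ℕ) (w : Fin (n + 1) → Fin S.N),
        0 < S.μ (cylinder S.Z S.T w) ∧ C = cylinder S.Z S.T w}] A → (x ∈ A ↔ x' ∈ A) := by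
    intro A hA
    induction A, hA using MeasurableSpace.generateFrom_induction with
    | hC C hC _ =>
      obtain ⟨m, w, -, rfl⟩ := hC
      exact forall_congr' fun k => hit k (w k)
    | empty => simp
    | compl A _ ih => exact not_congr ih
    | iUnion f _ ih => simp only [mem_iUnion, ih]
  exact key _ (hB' n)

namespace Tower

variable {d : ℕ} {S : PiecewiseSystem d} (H : Tower S)

/-- The points of `Q ∩ D u` that return to `D u` forever and meet the partition in one element at
each time. -/
def recurrentSet (Q : Set S.X) (u : ℕ) : Set S.X :=
  {x | ∀ n : ℕ, (H.levelReturn u)^[n] x ∈ Q ∩ H.D u ∧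
    H.IsLoop u (H.loopOf u ((H.levelReturn u)^[n] x)) ∧
    ∀ (k : ℕ) (i j : Fin S.N), S.T^[k] ((H.levelReturn u)^[n] x) ∈ S.Z i →
      S.T^[k] ((H.levelReturn u)^[n] x) ∈ S.Z j → i = j}

/-- The heights all of whose preimages lie in strips of first return paths. -/
def recurrentHeights (μhat : Measure (S.X × ℕ)) (u : ℕ) : Set ℝ :=
  {y | ∀ n : ℕ, H.IsLoop u (H.backLoop μhat u ((H.backMap μhat u)^[n] y))}

variable {H}

theorem levelReturn_mem_recurrentSet {Q : Set S.X} {u : ℕ} {x : S.X}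
    (hx : x ∈ H.recurrentSet Q u) : H.levelReturn u x ∈ H.recurrentSet Q u :=
  fun n => hx (n + 1)

/-- At a time within the first loop both points lie in the same level, hence in the same partition
element; a later time is reduced by the length of that loop. -/
theorem exists_common_element {Q : Set S.X} {u : ℕ} (n : ℕ) {x x' : S.X}
    (hx : x ∈ H.recurrentSet Q u) (hx' : x' ∈ H.recurrentSet Q u)
    (he : ∀ k : ℕ, H.loopOf u ((H.levelReturn u)^[k] x) = H.loopOf u ((H.levelReturn u)^[k] x')) :
    ∃ j, S.T^[n] x ∈ S.Z j ∧ S.T^[n] x' ∈ S.Z j := by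
  induction n using Nat.strong_induction_on generalizing x x' with
  | _ n ih =>
    obtain ⟨l, hl⟩ : ∃ l, H.loopOf u x = l := ⟨_, rfl⟩
    have hl' : H.loopOf u x' = l := (he 0).symm.trans hl
    have hloop : H.IsLoop u l := hl ▸ (hx 0).2.1
    have hb := (loopOf_eq_iff hloop).1 hl
    have hb' := (loopOf_eq_iff hloop).1 hl'
    by_cases hn : n < l.length
    · have hmem : ∀ {v : ℕ} {l : List ℕ}, H.IsPath v l → ∀ t ∈ l, t ∈ H.α := by
        intro v l hp
        induction l with
        | nil => simp
        | cons a l ihl =>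
          intro t ht
          rcases List.mem_cons.1 ht with rfl | ht
          exacts [hp.1, ihl hp.2.2 t ht]
      have hα := hmem hloop.2 _ (List.getElem_mem hn)
      exact ⟨_, H.subset _ hα (iterate_mem_D_of_mem_branchSet hb n hn),
        H.subset _ hα (iterate_mem_D_of_mem_branchSet hb' n hn)⟩
    · have hpos : 0 < l.length := by
        obtain ⟨⟨a, rfl, -⟩, -⟩ := hloop
        simp
      obtain ⟨m, rfl⟩ := Nat.exists_eq_add_of_le' (not_lt.1 hn)
      have hG : H.levelReturn u x = S.T^[l.length] x := by rw [levelReturn, hl]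
      have hG' : H.levelReturn u x' = S.T^[l.length] x' := by rw [levelReturn, hl']
      have := ih m (by omega) (levelReturn_mem_recurrentSet hx) (levelReturn_mem_recurrentSet hx')
        fun k => he (k + 1)
      rwa [hG, hG', ← Function.iterate_add_apply, ← Function.iterate_add_apply] at this

theorem eq_of_loopOf_eq {Q : Set S.X} (hQ : ∀ x ∈ Q, ∀ x' ∈ Q,
      (∀ (k : ℕ) (j : Fin S.N), S.T^[k] x ∈ S.Z j ↔ S.T^[k] x' ∈ S.Z j) → x = x')
    {u : ℕ} {x x' : S.X}
    (hx : x ∈ H.recurrentSet Q u) (hx' : x' ∈ H.recurrentSet Q u)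
    (he : ∀ k : ℕ, H.loopOf u ((H.levelReturn u)^[k] x) = H.loopOf u ((H.levelReturn u)^[k] x')) :
    x = x' := by
  refine hQ x (hx 0).1.1 x' (hx' 0).1.1 fun k j => ?_
  obtain ⟨i, hi, hi'⟩ := exists_common_element k hx hx' he
  constructor
  · intro hj
    exact (hx 0).2.2 k i j hi hj ▸ hi'
  · intro hj
    exact (hx' 0).2.2 k i j hi' hj ▸ hi

theorem mem_of_isLoop_backLoop {μhat : Measure (S.X × ℕ)} (h : H.IsLift μhat) {u : ℕ}
    (hu : u ∈ H.α) {y : ℝ} (hy : H.IsLoop u (H.backLoop μhat u y)) :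
    y ∈ Ioo 0 (H.rho μhat u) ∧ H.backMap μhat u y ∈ Ioo 0 (H.rho μhat u) := by
  have := (backLoop_eq_iff h hy).1 rfl
  exact ⟨strip_subset h hu hy this, mem_strip_iff.1 this⟩

section Lift

variable {μhat : Measure (S.X × ℕ)} (h : H.IsLift μhat) {u : ℕ} (hu : u ∈ H.α)
  (hpos : 0 < μhat (H.level u))
include h hu hpos

theorem ae_mem_recurrentSet {Q : Set S.X} (hQ : ∀ᵐ x ∂S.μ, x ∈ Q) :
    ∀ᵐ x ∂normalized S.μ (H.D u), x ∈ H.recurrentSet Q u := by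
  have := isProbabilityMeasure_loopLaw h hu hpos
  refine (fullBranch_level h hu hpos).ae_iterate (P := fun x => x ∈ Q ∩ H.D u ∧
    H.IsLoop u (H.loopOf u x) ∧
    ∀ (k : ℕ) (i j : Fin S.N), S.T^[k] x ∈ S.Z i → S.T^[k] x ∈ S.Z j → i = j) ?_
  have h1 : ∀ᵐ x ∂normalized S.μ (H.D u), x ∈ H.D u :=
    (ae_normalized_iff (H.nullMeasurableSet_D hu) (measure_ne_top _ _)).2 (.of_forall fun _ hx => hx)
  have hac : normalized S.μ (H.D u) ≪ S.μ := normalized_absolutelyContinuous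
  filter_upwards [h1, hac.ae_le hQ, hac.ae_le (S.ae_iterate S.ae_unique),
    ae_isLoop_loopOf h hu hpos] with x hx hx1 hx2 hx3
  exact ⟨⟨hx1, hx⟩, hx3, hx2⟩

theorem ae_mem_recurrentHeights :
    ∀ᵐ y ∂normalized volume (Icc 0 (H.rho μhat u)), y ∈ H.recurrentHeights μhat u := by
  have := isProbabilityMeasure_loopLaw h hu hpos
  exact (fullBranch_height h hu hpos).ae_iterate (ae_isLoop_backLoop h hu hpos)

/-- If one loop were almost sure, almost all points of `D u` would share one itinerary and therefore
coincide, giving an atom. -/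
theorem loopLaw_singleton_lt_one (hna : ∀ x : S.X, S.μ {x} = 0) (l : List ℕ) :
    H.loopLaw u {l} < 1 := by
  have := isProbabilityMeasure_loopLaw h hu hpos
  have := isProbabilityMeasure_level (H := H) hu
  refine lt_of_le_of_ne prob_le_one fun h1 => ?_
  obtain ⟨Q, hQ, hsep⟩ := S.exists_separated
  have h2 : ∀ᵐ x ∂normalized S.μ (H.D u), H.loopOf u x = l := by
    have h3 := (prob_compl_eq_zero_iff (μ := H.loopLaw u) (s := {l}) .of_discrete).2 h1
    rw [loopLaw, Measure.map_apply_of_aemeasurable (aemeasurable_loopOf h hu hpos)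
      .of_discrete] at h3
    exact h3
  have h3 : ∀ᵐ x ∂normalized S.μ (H.D u), x ∈ H.recurrentSet Q u ∧
      ∀ n : ℕ, H.loopOf u ((H.levelReturn u)^[n] x) = l :=
    (ae_mem_recurrentSet h hu hpos hQ).and ((fullBranch_level h hu hpos).ae_iterate h2)
  obtain ⟨x, hx, hx'⟩ := h3.exists
  have h4 : ∀ᵐ y ∂normalized S.μ (H.D u), y ∈ ({x} : Set S.X) := by
    filter_upwards [h3] with y hy
    exact eq_of_loopOf_eq hsep hy.1 hx fun k => (hy.2 k).trans (hx' k).symm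
  have h5 : normalized S.μ (H.D u) {x} = 0 := normalized_absolutelyContinuous (hna x)
  have h6 : ∀ᵐ y ∂normalized S.μ (H.D u), False := by
    filter_upwards [h4, measure_eq_zero_iff_ae_notMem.1 h5] with y hy hy' using hy' hy
  exact h6.exists.choose_spec

/-- Since `1 / jac l` is the probability of `l`, for any loop `l₀` of positive probability the
larger of `p {l₀}` and `1 - p {l₀}` bounds all contraction ratios. -/
theorem exists_contraction (hna : ∀ x : S.X, S.μ {x} = 0) :
    ∃ q : ℝ, 0 ≤ q ∧ q < 1 ∧ ∀ l, H.IsLoop u l → (H.jac l : ℝ)⁻¹ ≤ q := by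
  have := isProbabilityMeasure_loopLaw h hu hpos
  obtain ⟨l₀, hl₀⟩ : ∃ l, H.loopLaw u {l} ≠ 0 := by
    by_contra! hz
    have : H.loopLaw u univ = 0 := by
      rw [← iUnion_of_singleton, measure_iUnion_null_iff]
      exact hz
    simp at this
  have hc : H.loopLaw u {l₀}ᶜ < 1 := by
    rw [prob_compl_eq_one_sub .of_discrete]
    exact ENNReal.sub_lt_self ENNReal.one_ne_top one_ne_zero hl₀
  have hq : max (H.loopLaw u {l₀}) (H.loopLaw u {l₀}ᶜ) < 1 :=
    max_lt (loopLaw_singleton_lt_one h hu hpos hna l₀) hc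
  refine ⟨(max (H.loopLaw u {l₀}) (H.loopLaw u {l₀}ᶜ)).toReal, ENNReal.toReal_nonneg, ?_, ?_⟩
  · simpa using (ENNReal.toReal_lt_toReal hq.ne_top ENNReal.one_ne_top).2 hq
  · intro l hl
    have h1 : H.loopLaw u {l} ≤ max (H.loopLaw u {l₀}) (H.loopLaw u {l₀}ᶜ) := by
      by_cases he : l = l₀
      · exact he ▸ le_max_left _ _
      · exact (measure_mono (singleton_subset_iff.2 he)).trans (le_max_right _ _)
    rw [loopLaw_singleton h hu hpos hl] at h1
    simpa using ENNReal.toReal_mono hq.ne_top h1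

/-- While the backward loops agree, the distance of the two heights expands by at least `1/q` (when
`q > 0`) at each step, yet stays below `ρ`. -/
theorem eq_of_backLoop_eq (hna : ∀ x : S.X, S.μ {x} = 0) {y y' : ℝ}
    (hy : y ∈ H.recurrentHeights μhat u) (hy' : y' ∈ H.recurrentHeights μhat u)
    (he : ∀ k : ℕ, H.backLoop μhat u ((H.backMap μhat u)^[k] y) =
      H.backLoop μhat u ((H.backMap μhat u)^[k] y')) : y = y' := by
  obtain ⟨q, hq0, hq1, hq⟩ := exists_contraction h hu hpos hna
  have key : ∀ (n : ℕ) (y y' : ℝ), y ∈ H.recurrentHeights μhat u →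
      y' ∈ H.recurrentHeights μhat u →
      (∀ k : ℕ, H.backLoop μhat u ((H.backMap μhat u)^[k] y) =
        H.backLoop μhat u ((H.backMap μhat u)^[k] y')) → |y - y'| ≤ q ^ n * H.rho μhat u := by
    intro n
    induction n with
    | zero =>
      intro y y' hy hy' _
      have h1 := (mem_of_isLoop_backLoop h hu (hy 0)).1
      have h2 := (mem_of_isLoop_backLoop h hu (hy' 0)).1
      rw [Function.iterate_zero_apply] at h1 h2
      rw [pow_zero, one_mul, abs_le]
      constructor <;> linarith [h1.1, h1.2, h2.1, h2.2]
    | succ n ih =>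
      intro y y' hy hy' he
      have h1 := ih _ _ (fun k => hy (k + 1)) (fun k => hy' (k + 1)) fun k => he (k + 1)
      have h0 : H.backLoop μhat u y = H.backLoop μhat u y' := he 0
      have hJ : (0 : ℝ) < H.jac (H.backLoop μhat u y) := by exact_mod_cast jac_pos _
      have h2 : H.backMap μhat u y - H.backMap μhat u y' =
          (y - y') * (H.jac (H.backLoop μhat u y) : ℝ) := by
        rw [backMap, backMap, ← h0]
        ring
      rw [h2, abs_mul, abs_of_pos hJ] at h1
      have h3 : |y - y'| = (H.jac (H.backLoop μhat u y) : ℝ)⁻¹ *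
          (|y - y'| * (H.jac (H.backLoop μhat u y) : ℝ)) := by
        field_simp
      rw [h3, pow_succ', mul_assoc]
      exact mul_le_mul (hq _ (hy 0)) h1 (by positivity) hq0
  have hlim : Tendsto (fun n : ℕ => q ^ n * H.rho μhat u) atTop (𝓝 (0 * H.rho μhat u)) :=
    (tendsto_pow_atTop_nhds_zero_of_lt_one hq0 hq1).mul_const _
  rw [zero_mul] at hlim
  have := ge_of_tendsto' hlim fun n => key n y y' hy hy' he
  exact sub_eq_zero.1 (abs_eq_zero.1 (le_antisymm this (abs_nonneg _)))

end Lift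

/-! ### The first return map to a rug -/

theorem restrict_level {u : ℕ} (hu : u ∈ H.α) :
    H.muBar.restrict (H.level u) = (S.μ.restrict (H.D u)).map fun x => (x, u) := by
  have h1 : H.level u =ᵐ[H.muBar] sheet S u := by
    refine eventuallyEq_set.2 ?_
    rw [H.ae_muBar_iff]
    refine fun v hv => .of_forall fun x hx => ⟨fun hp => ⟨trivial, hp.1⟩, fun hp => ?_⟩
    obtain rfl : v = u := hp.2
    exact ⟨rfl, hx⟩
  rw [Measure.restrict_congr_set h1]
  ext E hE
  have hm : Measurable fun x : S.X => (x, u) := by fun_prop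
  rw [Measure.restrict_apply hE, muBar_eq, weighted_apply _ _ (hE.inter (measurableSet_sheet u)),
    tsum_eq_single ⟨u, hu⟩, Measure.map_apply hm hE, Measure.restrict_apply (hm hE), inter_comm]
  · simp [sheet, preimage]
  · intro v hv
    have : (v : ℕ) ≠ u := fun h => hv (Subtype.ext h)
    simp [sheet, this]

/-- The rug carries a product probability measure, so the coding of `x` and that of `y` are
independent. -/
theorem nuRug_eq {μhat : Measure (S.X × ℕ)} {u : ℕ} (hu : u ∈ H.α) : H.nuRug μhat u =
    ((normalized S.μ (H.D u)).prod (normalized volume (Icc 0 (H.rho μhat u)))).map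
      fun z => ((z.1, u), z.2) := by
  have hsf : SFinite H.muBar := by
    unfold muBar
    infer_instance
  have hm : Measurable fun x : S.X => (x, u) := by fun_prop
  have h1 : (H.nu μhat).restrict (H.rug μhat u) =
      ((S.μ.restrict (H.D u)).prod (volume.restrict (Icc 0 (H.rho μhat u)))).map
        fun z => ((z.1, u), z.2) := by
    have hsub : H.rug μhat u ⊆ H.rugs μhat :=
      subset_biUnion_of_mem (u := fun u => H.rug μhat u) hu
    rw [nu, Measure.restrict_restrict_of_subset hsub, rug, ← Measure.prod_restrict,
      restrict_level hu]
    have := Measure.map_prod_map (S.μ.restrict (H.D u))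
      (volume.restrict (Icc 0 (H.rho μhat u))) hm measurable_id
    rw [Measure.map_id] at this
    exact this
  have h2 : H.nu μhat (H.rug μhat u) = S.μ (H.D u) * volume (Icc 0 (H.rho μhat u)) := by
    rw [← Measure.restrict_apply_univ, h1, Measure.map_apply (by fun_prop) .univ, preimage_univ,
      ← univ_prod_univ, Measure.prod_prod, Measure.restrict_apply_univ,
      Measure.restrict_apply_univ]
  rw [nuRug, h1, h2, ENNReal.mul_inv (Or.inl (H.measure_D_pos hu).ne')
    (Or.inl (measure_ne_top _ _)), normalized, normalized, Measure.prod_smul_left,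
    Measure.prod_smul_right, smul_smul, Measure.map_smul]

section Return

variable {μhat : Measure (S.X × ℕ)} (h : H.IsLift μhat) {u : ℕ} (hu : u ∈ H.α)
include h hu

theorem returnMap_eq {x : S.X} (hx : H.IsLoop u (H.loopOf u x)) {y : ℝ}
    (hy : y ∈ Ioo 0 (H.rho μhat u)) :
    (∃ n : ℕ, 1 ≤ n ∧ (H.natExt μhat)^[n] ((x, u), y) ∈ H.rug μhat u) ∧
      H.returnMap μhat u ((x, u), y) =
        ((H.levelReturn u x, u), H.heightMap μhat u (H.loopOf u x) y) := by
  obtain ⟨l, hl⟩ : ∃ l, H.loopOf u x = l := ⟨_, rfl⟩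
  rw [levelReturn, hl]
  rw [hl] at hx
  have hb := (loopOf_eq_iff hx).1 hl
  have hhead := hx.headD_eq u
  have h1 := natExt_iterate (μhat := μhat) hb y
  rw [hhead] at h1
  have hlen : 1 ≤ l.length := by
    obtain ⟨⟨a, rfl, -⟩, -⟩ := hx
    simp
  have hmem : (H.natExt μhat)^[l.length] ((x, u), y) ∈ H.rug μhat u := by
    rw [h1]
    exact ⟨⟨rfl, iterate_mem_of_mem_branchSet hb⟩,
      Ioo_subset_Icc_self (h.heightMap_mem hu hx.2 (by rwa [hhead]))⟩
  refine ⟨⟨_, hlen, hmem⟩, ?_⟩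
  have htime : H.returnTime μhat u ((x, u), y) = l.length := by
    refine le_antisymm (Nat.sInf_le ⟨hlen, hmem⟩) (le_csInf ⟨_, hlen, hmem⟩ ?_)
    rintro n ⟨hn, hn'⟩
    -- An earlier return would put `u` at a position `n ≥ 1` of the loop, that is, in the tail that
    -- avoids `u`.
    by_contra hlt
    have h2 := natExt_iterate_level (μhat := μhat) hb y n (not_le.1 hlt)
    rw [hhead] at h2
    have h3 : u = l[n] := hn'.1.1.symm.trans h2
    obtain ⟨⟨a, rfl, ha⟩, -⟩ := hx
    obtain ⟨n, rfl⟩ := Nat.exists_eq_add_of_le' hn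
    exact ha (h3 ▸ List.getElem_mem _)
  rw [returnMap, htime, h1]

variable (hpos : 0 < μhat (H.level u))
include hpos

theorem ae_nuRug {Q : Set S.X} (hQ : ∀ᵐ x ∂S.μ, x ∈ Q) : ∀ᵐ z ∂H.nuRug μhat u,
    z.1.1 ∈ H.recurrentSet Q u ∧ z.1.2 = u ∧ z.2 ∈ H.recurrentHeights μhat u := by
  have := isProbabilityMeasure_level (H := H) hu
  have := isProbabilityMeasure_height h hu hpos
  have hemb : MeasurableEmbedding fun z : S.X × ℝ => ((z.1, u), z.2) :=
    (measurableEmbedding_mk u).prodMap MeasurableEmbedding.id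
  rw [nuRug_eq hu, hemb.ae_map_iff]
  filter_upwards [Measure.quasiMeasurePreserving_fst.ae (ae_mem_recurrentSet h hu hpos hQ),
    Measure.quasiMeasurePreserving_snd.ae (ae_mem_recurrentHeights h hu hpos)] with z h1 h2
  exact ⟨h1, rfl, h2⟩

/-- The alphabet consists of the loops. The return map pushes the height into the strip of the loop
just followed by `x`, so that loop becomes the first backward symbol and `backMap` restores the old
height: exactly a shift of the two-sided code. -/
theorem isBernoulli_returnMap (hna : ∀ x : S.X, S.μ {x} = 0) :
    IsBernoulli (H.nuRug μhat u) (H.returnMap μhat u) := by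
  have := isProbabilityMeasure_level (H := H) hu
  have := isProbabilityMeasure_height h hu hpos
  have := isProbabilityMeasure_loopLaw h hu hpos
  have hX := fullBranch_level h hu hpos
  have hY := fullBranch_height h hu hpos
  obtain ⟨Q, hQ, hsep⟩ := S.exists_separated
  refine ⟨List ℕ, inferInstance, inferInstance, inferInstance, H.loopLaw u, inferInstance, ?_⟩
  have hemb : MeasurableEmbedding fun z : S.X × ℝ => ((z.1, u), z.2) :=
    (measurableEmbedding_mk u).prodMap MeasurableEmbedding.id
  set c := code (H.loopOf u) (H.levelReturn u) (H.backLoop μhat u) (H.backMap μhat u) with hc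
  set φ : (S.X × ℕ) × ℝ → ℤ → List ℕ := fun z => c (z.1.1, z.2) with hφ
  have hφm : AEMeasurable φ (H.nuRug μhat u) := by
    rw [nuRug_eq hu, hemb.aemeasurable_map_iff]
    exact aemeasurable_code hX hY
  have hmap : (H.nuRug μhat u).map φ = Measure.infinitePi fun _ : ℤ => H.loopLaw u := by
    rw [← map_code hX hY, nuRug_eq hu,
      AEMeasurable.map_map_of_aemeasurable _ hemb.measurable.aemeasurable]
    · rfl
    · rw [hemb.aemeasurable_map_iff]
      exact aemeasurable_code hX hY
  rw [← hmap]
  have hret : ∀ z : (S.X × ℕ) × ℝ, z.1.1 ∈ H.recurrentSet Q u ∧ z.1.2 = u ∧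
      z.2 ∈ H.recurrentHeights μhat u →
      H.returnMap μhat u z =
        ((H.levelReturn u z.1.1, u), H.heightMap μhat u (H.loopOf u z.1.1) z.2) ∧
      H.backLoop μhat u (H.heightMap μhat u (H.loopOf u z.1.1) z.2) = H.loopOf u z.1.1 ∧
      H.backMap μhat u (H.heightMap μhat u (H.loopOf u z.1.1) z.2) = z.2 := by
    rintro ⟨⟨x, v⟩, y⟩ ⟨hx, rfl, hy⟩
    have hl : H.IsLoop v (H.loopOf v x) := (hx 0).2.1
    have hyI : y ∈ Ioo 0 (H.rho μhat v) := (mem_of_isLoop_backLoop h hu (hy 0)).1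
    have h1 : H.backLoop μhat v (H.heightMap μhat v (H.loopOf v x) y) = H.loopOf v x :=
      (backLoop_eq_iff h hl).2 ⟨y, hyI, rfl⟩
    have hJ : (H.jac (H.loopOf v x) : ℝ) ≠ 0 := by exact_mod_cast (jac_pos _).ne'
    refine ⟨(returnMap_eq h hu hl hyI).2, h1, ?_⟩
    rw [backMap, h1, heightMap_eq, add_sub_cancel_right]
    exact div_mul_cancel₀ _ hJ
  refine isIsomorphic_of_injOn hφm (Y' := {z | z.1.1 ∈ H.recurrentSet Q u ∧ z.1.2 = u ∧
    z.2 ∈ H.recurrentHeights μhat u}) (ae_nuRug h hu hpos hQ) ?_ ?_ ?_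
  · intro z hz
    obtain ⟨h1, h2, h3⟩ := hret z hz
    rw [h1]
    refine ⟨levelReturn_mem_recurrentSet hz.1, rfl, fun n => ?_⟩
    cases n with
    | zero =>
      rw [Function.iterate_zero_apply, h2]
      exact (hz.1 0).2.1
    | succ n =>
      rw [Function.iterate_succ_apply, h3]
      exact hz.2.2 n
  · rintro ⟨⟨x, v⟩, y⟩ ⟨hx, hv, hy⟩ ⟨⟨x', v'⟩, y'⟩ ⟨hx', hv', hy'⟩ he
    obtain rfl : x = x' := eq_of_loopOf_eq hsep hx hx' fun k => congrFun he (Int.ofNat k)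
    obtain rfl : y = y' :=
      eq_of_backLoop_eq h hu hpos hna hy hy' fun k => congrFun he (Int.negSucc k)
    obtain rfl : v = v' := hv.trans hv'.symm
    rfl
  · intro z hz
    obtain ⟨h1, h2, h3⟩ := hret z hz
    refine shift_code ?_ ?_ ?_
    · rw [h1]
    · rw [h1]
      exact h2
    · rw [h1]
      exact h3

theorem ae_exists_natExt_mem : ∀ᵐ z ∂H.nuRug μhat u,
    ∃ n : ℕ, 1 ≤ n ∧ (H.natExt μhat)^[n] z ∈ H.rug μhat u := by
  obtain ⟨Q, hQ, -⟩ := S.exists_separated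
  filter_upwards [ae_nuRug h hu hpos hQ]
  rintro ⟨⟨x, v⟩, y⟩ ⟨hx, hv, hy⟩
  obtain rfl : v = u := hv
  exact (returnMap_eq h hu (hx 0).2.1 (mem_of_isLoop_backLoop h hu (hy 0)).1).1

end Return

end Tower
end RugTower

end

theorem theoremt (d : ℕ) (S : RugTower.PiecewiseSystem d) (hna : ∀ x : S.X, S.μ {x} = 0)
    (H : RugTower.Tower S) (μhat : Measure (S.X × ℕ)) (hlift : H.IsLift μhat)
    (u : ℕ) (hu : u ∈ H.α) (hpos : 0 < μhat (H.level u)) :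
    (∀ᵐ z ∂(H.nuRug μhat u), ∃ n : ℕ, 1 ≤ n ∧ (H.natExt μhat)^[n] z ∈ H.rug μhat u) ∧
      RugTower.IsBernoulli (H.nuRug μhat u) (H.returnMap μhat u) :=
  ⟨RugTower.Tower.ae_exists_natExt_mem hlift hu hpos,
    RugTower.Tower.isBernoulli_returnMap hlift hu hpos hna⟩
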